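/- Types of the scalable ZX-calculus (SZX) are finite formal sums $1_{n_1}+\dots+1_{n_k}$ with $n_i\ge 1$ ($1_n$ is a register of $n$ qubits, $k_n$ is the sum of $k$ copies of $1_n$). Diagrams are generated under $\circ$ and $\otimes$ by identities, green and red spiders $k_n\to\ell_n$ with phases in $\mathbb R^n$, Hadamards $1_n\to1_n$, swaps, cups, caps, dividers $1_{n+1}\to 1_1+1_n$, gatherers $1_1+1_n\to 1_{n+1}$, and matrices $A\in\mathbb F_2^{m\times n}$, $A:1_n\to 1_m$. Write $SZX\vdash f=g$ if $f=g$ follows from the congruence and symmetric strict monoidal laws and the axioms of the calculus: wires and spider legs may be bent and spider legs exchanged (only topology matters); spider fusion, identity and colour change for wires of any size; the copy, bialgebra, scalar and Euler rules of the ZX-calculus on single qubits; expansion and elimination of divider/gatherer pairs; distribution of dividers and gatherers over cups, caps, spiders and Hadamards; and the four matrix axioms ($1\times1$ zero and one, block rows, block columns). All rules on spiders hold with the colours exchanged. The backward matrix $A^{\dagger}:1_m\to1_n$ is $A$ with its legs bent by a cup and a cap, and $f^\dagger$ denotes the diagram $f$ turned upside down with phases negated. Let $a,b,c\ge 1$,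 $B\in\mathbb F_2^{a\times b}$, $P\in\mathbb F_2^{c\times b}$, $C\in\mathbb F_2^{c\times a}$. For $M\in\mathbb F_2^{m\times n}$ let $\mathrm{CX}_M:1_m+1_n\to1_m+1_n$ be the diagram made of a phase-free green dot on the register $1_n$ and a phase-free red dot on the register $1_m$, joined by the matrix $M$, together with the scalar diagram of value $\sqrt2^{\,m}$ (a green and a red dot joined by one wire of size $m$); it represents $|x\rangle|y\rangle\mapsto|x+My\rangle|y\rangle$. Let $J$ denote all-ones matrices, and let $g,h\in\{\text{green},\text{red}\}$. The tripartite CPC encoder $E:1_b\to1_a+1_b+1_c$ adds the two check registers and then applies, in this order, $\mathrm{CX}_B$ (from the register $1_b$ to $1_a$), $\mathrm{CX}_{C^t}$ (from $1_c$ to $1_a$) and $\mathrm{CX}_{P^t}$ (from $1_c$ to $1_b$). The register $1_a$ starts in the state given by a single-qubit phase-free dot of colour $g$ followed by $J\in\mathbb F_2^{a\times 1}$, and the register $1_c$ in the state given by a single-qubit phase-free dot of colour $h$ followed by the backward $J\in\mathbb F_2^{1\times c}$, with the scalar diagrams of values $1/\sqrt2$ and $1/\sqrt2^{\,c}$ (a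 green and a red dot joined by three wires). The decoder $D:1_a+1_b+1_c\to1_b$ is the mirror image of $E$. For $g$ green and $h$ red the check registers start in the normalised states proportional to $|0^a\rangle+|1^a\rangle$ and to the sum of all $|z\rangle$, $z\in\mathbb F_2^c$, of even weight; for $g$ red and $h$ green they start in $|0^a\rangle$ and $|{+}^c\rangle$. Then the encoder is an isometry, derivably in the calculus: for all $B,P,C$ and all $g,h$, $$SZX\vdash D\circ E=\mathrm{id}_{1_b}\qquad\text{and}\qquad SZX\vdash E^\dagger\circ E=\mathrm{id}_{1_b}.$$ -/

import Mathlib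

/-!
The scalable ZX-calculus with binary matrices: diagrams, derivability, and the tripartite
CPC encoder and decoder.
-/

noncomputable section

namespace SZX

/-- The two colours of spiders: green (Z) and red (X). -/
inductive Color where
  | green
  | red
  deriving DecidableEq

/-- The other colour. -/
def Color.swap : Color → Color
  | .green => .red
  | .red => .green

/-- Types are elements of the free monoid over the positive integers: the list
`[n₁, …, n_k]` stands for `1_{n₁} + ⋯ + 1_{n_k}`, a wire `n` being a register of `n` qubits,
and `List.replicate k n` stands for `k_n`. -/
abbrev Ty : Type := List ℕ+

/-- SZX-diagrams `a → b`, built from the generators by the sequential composition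
(`comp f g` is `g ∘ f`) and the parallel composition. `Diag.id []` is the empty diagram and
`Diag.id [n]` is the wire of size `n`. -/
inductive Diag : Ty → Ty → Type where
  | id (a : Ty) : Diag a a
  | spider (col : Color) (n : ℕ+) (k l : ℕ) (α : Fin (n : ℕ) → ℝ) :
      Diag (List.replicate k n) (List.replicate l n)
  | had (n : ℕ+) : Diag [n] [n]
  | swap (n m : ℕ+) : Diag [n, m] [m, n]
  | cup (n : ℕ+) : Diag [] [n, n]
  | cap (n : ℕ+) : Diag [n, n] []
  | divide (n : ℕ+) : Diag [n + 1] [1, n]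
  | gather (n : ℕ+) : Diag [1, n] [n + 1]
  | mat {m n : ℕ+} (A : Matrix (Fin (m : ℕ)) (Fin (n : ℕ)) (ZMod 2)) : Diag [n] [m]
  | comp {a b c : Ty} (f : Diag a b) (g : Diag b c) : Diag a c
  | tensor {a b c d : Ty} (f : Diag a b) (g : Diag c d) : Diag (a ++ c) (b ++ d)

infixl:65 " ⨟ " => Diag.comp
notation:70 f:71 " ⊠ " g:70 => (Diag.tensor f g :)

namespace Diag

/-- The same diagram, seen with equal (as lists) input and output types. -/
def cast {a a' b b' : Ty} (ha : a = a') (hb : b = b') (f : Diag a b) : Diag a' b' :=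
  ha ▸ hb ▸ f

/-- The wire of size `n`. -/
abbrev wire (n : ℕ+) : Diag [n] [n] := Diag.id [n]

/-- The phase-free spider. -/
def spider0 (col : Color) (n : ℕ+) (k l : ℕ) : Diag (List.replicate k n) (List.replicate l n) :=
  spider col n k l 0

/-- The phase-free spider without input. -/
def unit (col : Color) (n : ℕ+) : Diag [] [n] := spider0 col n 0 1

/-- The phase-free spider without output. -/
def counit (col : Color) (n : ℕ+) : Diag [n] [] := spider0 col n 1 0

/-- The phase-free spider with one input and two outputs. -/
def copy (col : Color) (n : ℕ+) : Diag [n] [n, n] := spider0 col n 1 2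

/-- The phase-free spider with two inputs and one output. -/
def merge (col : Color) (n : ℕ+) : Diag [n, n] [n] := spider0 col n 2 1

/-- The scalar made of two dots of opposite colours joined by one wire of size `n`
(its value is `√2 ^ n`). -/
def bone (col : Color) (n : ℕ+) : Diag [] [] := unit col n ⨟ counit col.swap n

/-- The scalar made of two dots of opposite colours joined by three wires of size `n`
(its value is `1 / √2 ^ n`). -/
def tripleBone (col : Color) (n : ℕ+) : Diag [] [] :=
  spider0 col n 0 3 ⨟ spider0 col.swap n 3 0

/-- `k` parallel Hadamards of size `n`. -/
def hads (n : ℕ+) : (k : ℕ) → Diag (List.replicate k n) (List.replicate k n)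
  | 0 => Diag.id []
  | k + 1 => had n ⊠ hads n k

/-- The wire `n` crossing all wires of `a`. -/
def braid (n : ℕ+) : (a : Ty) → Diag (n :: a) (a ++ [n])
  | [] => wire n
  | m :: a => (swap n m ⊠ Diag.id a) ⨟ (wire m ⊠ braid n a)

/-- The generalised divider `1_{a+b} → 1_a + 1_b`. -/
def gdivide (a b : ℕ+) : Diag [a + b] [a, b] :=
  PNat.recOn a
    (cast (by rw [add_comm]) rfl (divide b))
    (fun a ih =>
      cast (a := [a + b + 1]) (b := [a + 1, b]) (by rw [add_right_comm]) rfl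
        (divide (a + b) ⨟ (wire 1 ⊠ ih) ⨟ (gather a ⊠ wire b)))

/-- The generalised gatherer `1_a + 1_b → 1_{a+b}`. -/
def ggather (a b : ℕ+) : Diag [a, b] [a + b] :=
  PNat.recOn a
    (cast rfl (by rw [add_comm]) (gather b))
    (fun a ih =>
      cast (a := [a + 1, b]) (b := [a + b + 1]) rfl (by rw [add_right_comm])
        ((divide a ⊠ wire b) ⨟ (wire 1 ⊠ ih) ⨟ gather (a + b)))

/-- The backward matrix: the matrix generator with its legs bent. -/
def matBack {m n : ℕ+} (A : Matrix (Fin (m : ℕ)) (Fin (n : ℕ)) (ZMod 2)) : Diag [m] [n] :=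
  (cup n ⊠ wire m) ⨟ (wire n ⊠ mat A ⊠ wire m) ⨟ (wire n ⊠ cap m)

/-- The adjoint of a diagram: upside down, with opposite phases. -/
def dagger : {a b : Ty} → Diag a b → Diag b a
  | _, _, Diag.id a => Diag.id a
  | _, _, spider col n k l α => spider col n l k (-α)
  | _, _, had n => had n
  | _, _, swap n m => swap m n
  | _, _, cup n => cap n
  | _, _, cap n => cup n
  | _, _, divide n => gather n
  | _, _, gather n => divide n
  | _, _, mat A => matBack A
  | _, _, comp f g => dagger g ⨟ dagger f
  | _, _, tensor f g => dagger f ⊠ dagger g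

end Diag

/-- The parameters `(β₁, β₂, β₃, γ)` of the Euler rule. -/
def eulerParams (α₁ α₂ : ℝ) : ℝ × ℝ × ℝ × ℝ :=
  let xp : ℝ := (α₁ + α₂) / 2
  let xm : ℝ := xp - α₂
  let z : ℂ := -(Real.sin xp : ℂ) + Complex.I * (Real.cos xm : ℂ)
  let z' : ℂ := (Real.cos xp : ℂ) - Complex.I * (Real.sin xm : ℂ)
  let β₂ : ℝ := if z' = 0 then 0 else 2 * Complex.arg (Complex.I + (‖z / z'‖ : ℂ))
  (Complex.arg z + Complex.arg z', β₂, Complex.arg z - Complex.arg z',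
    xp - Complex.arg z + (Real.pi - β₂) / 2)

open Diag in
/-- `Derivable f g` is `SZX ⊢ f = g`. The two sides of a derivable equation always have equal
types (`Derivable.types_eq`), but these need not be the same expression (for example
`(a ++ c) ++ e` and `a ++ (c ++ e)`), hence the heterogeneous form of the relation.
Rules that mention a colour `col` hold for both colours, so that every rule comes with its
colour-swapped version. -/
inductive Derivable : {a b a' b' : Ty} → Diag a b → Diag a' b' → Prop where
  -- congruence
  | refl {a b} (f : Diag a b) : Derivable f f
  | symm {a b a' b'} {f : Diag a b} {g : Diag a' b'} : Derivable f g → Derivable g f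
  | trans {a b a' b' a'' b''} {f : Diag a b} {g : Diag a' b'} {h : Diag a'' b''} :
      Derivable f g → Derivable g h → Derivable f h
  | comp {a b c a' b' c'} {f : Diag a b} {g : Diag b c} {f' : Diag a' b'} {g' : Diag b' c'} :
      Derivable f f' → Derivable g g' → Derivable (f ⨟ g) (f' ⨟ g')
  | tensor {a b c d a' b' c' d'} {f : Diag a b} {g : Diag c d}
      {f' : Diag a' b'} {g' : Diag c' d'} :
      Derivable f f' → Derivable g g' → Derivable (f ⊠ g) (f' ⊠ g')
  -- diagrams form a strict symmetric monoidal category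
  | id_comp {a b} (f : Diag a b) : Derivable (Diag.id a ⨟ f) f
  | comp_id {a b} (f : Diag a b) : Derivable (f ⨟ Diag.id b) f
  | comp_assoc {a b c d} (f : Diag a b) (g : Diag b c) (h : Diag c d) :
      Derivable ((f ⨟ g) ⨟ h) (f ⨟ (g ⨟ h))
  | id_tensor_id (a b : Ty) : Derivable (Diag.id a ⊠ Diag.id b) (Diag.id (a ++ b))
  | empty_tensor {a b} (f : Diag a b) : Derivable (Diag.id [] ⊠ f) f
  | tensor_empty {a b} (f : Diag a b) : Derivable (f ⊠ Diag.id []) f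
  | tensor_assoc {a b c d e e'} (f : Diag a b) (g : Diag c d) (h : Diag e e') :
      Derivable ((f ⊠ g) ⊠ h) (f ⊠ (g ⊠ h))
  | interchange {a b c a' b' c'} (f : Diag a b) (g : Diag b c) (f' : Diag a' b')
      (g' : Diag b' c') :
      Derivable ((f ⊠ f') ⨟ (g ⊠ g')) ((f ⨟ g) ⊠ (f' ⨟ g'))
  | swap_swap (n m : ℕ+) : Derivable (swap n m ⨟ swap m n) (Diag.id [n, m])
  | swap_natural (n : ℕ+) {a b} (f : Diag a b) :
      Derivable ((wire n ⊠ f) ⨟ braid n b) (braid n a ⨟ (f ⊠ wire n))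
  -- only topology matters: bending wires, exchanging and bending legs of spiders
  | cup_swap (n : ℕ+) : Derivable (cup n ⨟ swap n n) (cup n)
  | swap_cap (n : ℕ+) : Derivable (swap n n ⨟ cap n) (cap n)
  | snake (n : ℕ+) : Derivable ((cup n ⊠ wire n) ⨟ (wire n ⊠ cap n)) (wire n)
  | snake' (n : ℕ+) : Derivable ((wire n ⊠ cup n) ⨟ (cap n ⊠ wire n)) (wire n)
  | spider_swap_out (col : Color) (n : ℕ+) (k i j : ℕ) (α : Fin (n : ℕ) → ℝ) :
      Derivable
        ((spider col n k (i + (2 + j)) α).cast rfl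
            (by rw [List.replicate_add, List.replicate_add]; rfl) ⨟
          (Diag.id (List.replicate i n) ⊠ swap n n ⊠ Diag.id (List.replicate j n)))
        (spider col n k (i + (2 + j)) α)
  | spider_swap_in (col : Color) (n : ℕ+) (i j l : ℕ) (α : Fin (n : ℕ) → ℝ) :
      Derivable
        ((Diag.id (List.replicate i n) ⊠ swap n n ⊠ Diag.id (List.replicate j n)) ⨟
          (spider col n (i + (2 + j)) l α).cast
            (by rw [List.replicate_add, List.replicate_add]; rfl) rfl)
        (spider col n (i + (2 + j)) l α)
  | spider_bend_in (col : Color) (n : ℕ+) (k l : ℕ) (α : Fin (n : ℕ) → ℝ) :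
      Derivable (spider col n (k + 1) l α)
        ((wire n ⊠ spider col n k (l + 1) α) ⨟ (cap n ⊠ Diag.id (List.replicate l n)))
  | spider_bend_out (col : Color) (n : ℕ+) (k l : ℕ) (α : Fin (n : ℕ) → ℝ) :
      Derivable (spider col n k (l + 1) α)
        ((cup n ⊠ Diag.id (List.replicate k n)) ⨟ (wire n ⊠ spider col n (k + 1) l α))
  -- spiders of any size: fusion along `m + 1` wires, identity, change of colour
  | fusion (col : Color) (n : ℕ+) (k k' l l' m : ℕ) (α β : Fin (n : ℕ) → ℝ) :
      Derivable
        ((spider col n k (l + (m + 1)) α ⊠ Diag.id (List.replicate k' n)) ⨟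
          (Diag.id (List.replicate l n) ⊠ spider col n ((m + 1) + k') l' β).cast
            (by simp only [← List.replicate_add, add_assoc]) rfl)
        (spider col n (k + k') (l + l') (α + β))
  | spider_id (col : Color) (n : ℕ+) : Derivable (spider0 col n 1 1) (wire n)
  | color_change (col : Color) (n : ℕ+) (k l : ℕ) (α : Fin (n : ℕ) → ℝ) :
      Derivable (hads n k ⨟ spider col n k l α ⨟ hads n l) (spider col.swap n k l α)
  -- single-qubit rules: inverse of the scalar `√2`, copy, bialgebra, Euler
  | bone_inv (col : Color) : Derivable (bone col 1 ⊠ tripleBone col 1) (Diag.id [])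
  | copy_rule (col : Color) :
      Derivable (bone col 1 ⊠ (unit col.swap 1 ⨟ copy col 1)) (unit col.swap 1 ⊠ unit col.swap 1)
  | bialgebra (col : Color) :
      Derivable (merge col.swap 1 ⨟ copy col 1)
        (bone col 1 ⊠
          ((copy col 1 ⊠ copy col 1) ⨟ (wire 1 ⊠ swap 1 1 ⊠ wire 1) ⨟
            (merge col.swap 1 ⊠ merge col.swap 1)))
  | euler (col : Color) (α₁ α₂ β₁ β₂ β₃ γ : ℝ) (h : eulerParams α₁ α₂ = (β₁, β₂, β₃, γ)) :
      Derivable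
        (spider col 1 1 1 (fun _ => α₁) ⨟ had 1 ⨟ spider col 1 1 1 (fun _ => α₂))
        ((spider col 1 0 1 (fun _ => γ) ⨟ spider col.swap 1 1 0 (fun _ => Real.pi)) ⊠
          tripleBone col 1 ⊠
          (spider col.swap 1 1 1 (fun _ => β₁) ⨟ spider col 1 1 1 (fun _ => β₂) ⨟
            spider col.swap 1 1 1 (fun _ => β₃)))
  -- dividers and gatherers: expansion and elimination
  | expansion (n : ℕ+) : Derivable (divide n ⨟ gather n) (wire (n + 1))
  | elimination (n : ℕ+) : Derivable (gather n ⨟ divide n) (Diag.id [1, n])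
  -- distribution of dividers over the generators
  | cup_divide (n : ℕ+) :
      Derivable (cup (n + 1) ⨟ (divide n ⊠ divide n))
        ((cup 1 ⊠ cup n) ⨟ (wire 1 ⊠ swap 1 n ⊠ wire n))
  | gather_cap (n : ℕ+) :
      Derivable ((gather n ⊠ gather n) ⨟ cap (n + 1))
        ((wire 1 ⊠ swap n 1 ⊠ wire n) ⨟ (cap 1 ⊠ cap n))
  | copy_divide (col : Color) (n : ℕ+) :
      Derivable (copy col (n + 1) ⨟ (divide n ⊠ divide n))
        (divide n ⨟ (copy col 1 ⊠ copy col n) ⨟ (wire 1 ⊠ swap 1 n ⊠ wire n))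
  | unit_divide (col : Color) (n : ℕ+) (α : ℝ) (β : Fin (n : ℕ) → ℝ) :
      Derivable
        (spider col (n + 1) 0 1 (Fin.cons α β : Fin ((n : ℕ) + 1) → ℝ) ⨟ divide n)
        (spider col 1 0 1 (fun _ => α) ⊠ spider col n 0 1 β)
  | had_divide (n : ℕ+) :
      Derivable (had (n + 1) ⨟ divide n) (divide n ⨟ (had 1 ⊠ had n))
  -- matrices: zero, one, and the two block rules
  | mat_zero :
      Derivable (mat (m := 1) (n := 1) 0)
        (tripleBone .green 1 ⊠ (counit .green 1 ⨟ unit .red 1))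
  | mat_one : Derivable (mat (m := 1) (n := 1) 1) (wire 1)
  | mat_rows {a b n : ℕ+} (A : Matrix (Fin (a : ℕ)) (Fin (n : ℕ)) (ZMod 2))
      (B : Matrix (Fin (b : ℕ)) (Fin (n : ℕ)) (ZMod 2)) :
      Derivable
        (mat (m := a + b) (n := n)
            (Matrix.of (Fin.append A B : Fin ((a : ℕ) + b) → Fin (n : ℕ) → ZMod 2)) ⨟
          gdivide a b)
        (copy .green n ⨟ (mat A ⊠ mat B))
  | mat_cols {c d m : ℕ+} (C : Matrix (Fin (m : ℕ)) (Fin (c : ℕ)) (ZMod 2))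
      (D : Matrix (Fin (m : ℕ)) (Fin (d : ℕ)) (ZMod 2)) :
      Derivable
        (ggather c d ⨟
          mat (m := m) (n := c + d)
            (Matrix.of fun i => (Fin.append (C i) (D i) : Fin ((c : ℕ) + d) → ZMod 2)))
        (bone .green m ⊠ ((mat C ⊠ mat D) ⨟ merge .red m))

/-- Both sides of a derivable equation have the same input and output types. -/
theorem Derivable.types_eq {a b a' b' : Ty} {f : Diag a b} {g : Diag a' b'}
    (h : Derivable f g) : a = a' ∧ b = b' := by
  induction h with
  | symm _ ih => exact ⟨ih.1.symm, ih.2.symm⟩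
  | trans _ _ ih ih' => exact ⟨ih.1.trans ih'.1, ih.2.trans ih'.2⟩
  | comp _ _ ih ih' => exact ⟨ih.1, ih'.2⟩
  | tensor _ _ ih ih' => exact ⟨by rw [ih.1, ih'.1], by rw [ih.2, ih'.2]⟩
  | tensor_empty f => simp
  | tensor_assoc f g h => simp
  | spider_swap_out => exact ⟨rfl, by rw [List.replicate_add, List.replicate_add]; rfl⟩
  | spider_swap_in => exact ⟨by rw [List.replicate_add, List.replicate_add]; rfl, rfl⟩
  | fusion => simp
  | _ => exact ⟨rfl, rfl⟩

namespace CPC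

open Diag

/-- The controlled-NOT of a target register `a` and a control register `b` along a matrix
`M : 1_b → 1_a`: a green dot on `b`, a red dot on `a`, joined by `M`, and the scalar `√2 ^ a`.
It maps `|x⟩|y⟩` to `|x + M y⟩|y⟩`. -/
def cnot {a b : ℕ+} (M : Matrix (Fin (a : ℕ)) (Fin (b : ℕ)) (ZMod 2)) : Diag [a, b] [a, b] :=
  bone .green a ⊠
    ((wire a ⊠ copy .green b) ⨟ (wire a ⊠ mat M ⊠ wire b) ⨟ (merge .red a ⊠ wire b))

/-- The all-ones matrix. -/
def ones (m n : ℕ+) : Matrix (Fin (m : ℕ)) (Fin (n : ℕ)) (ZMod 2) := Matrix.of fun _ _ => 1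

section

variable {a b c : ℕ+} (B : Matrix (Fin (a : ℕ)) (Fin (b : ℕ)) (ZMod 2))
  (P : Matrix (Fin (c : ℕ)) (Fin (b : ℕ)) (ZMod 2))
  (C : Matrix (Fin (c : ℕ)) (Fin (a : ℕ)) (ZMod 2))

/-- Bit checks: the data register controls the first check register, along `B`. -/
def bitCheck : Diag [a, b, c] [a, b, c] := cnot B ⊠ wire c

/-- Phase checks: the colour-reversed counterpart of the coupling of the data register to the
second check register along `P`. -/
def phaseCheck : Diag [a, b, c] [a, b, c] := wire a ⊠ cnot P.transpose

/-- Cross checks: the colour-reversed counterpart of the coupling of the first check register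
to the second one along `C`. -/
def crossCheck : Diag [a, b, c] [a, b, c] :=
  (wire a ⊠ swap b c) ⨟ (cnot C.transpose ⊠ wire b) ⨟ (wire a ⊠ swap c b)

end

/-- The initial state of the first check register: a single-qubit dot of colour `g`, followed
by the all-ones matrix. -/
def prepA (g : Color) (a : ℕ+) : Diag [] [a] :=
  tripleBone .green 1 ⊠ (unit g 1 ⨟ mat (ones a 1))

/-- The initial state of the second check register: a single-qubit dot of colour `h`, followed
by the backward all-ones matrix. -/
def prepC (h : Color) (c : ℕ+) : Diag [] [c] :=
  tripleBone .green c ⊠ (unit h 1 ⨟ matBack (ones 1 c))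

/-- The effect on the first check register, mirror image of `prepA`. -/
def testA (g : Color) (a : ℕ+) : Diag [a] [] :=
  tripleBone .green 1 ⊠ (matBack (ones a 1) ⨟ counit g 1)

/-- The effect on the second check register, mirror image of `prepC`. -/
def testC (h : Color) (c : ℕ+) : Diag [c] [] :=
  tripleBone .green c ⊠ (mat (ones 1 c) ⨟ counit h 1)

/-- The tripartite CPC encoder `1_b → 1_a + 1_b + 1_c`. -/
def encoder (g h : Color) {a b c : ℕ+} (B : Matrix (Fin (a : ℕ)) (Fin (b : ℕ)) (ZMod 2))
    (P : Matrix (Fin (c : ℕ)) (Fin (b : ℕ)) (ZMod 2))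
    (C : Matrix (Fin (c : ℕ)) (Fin (a : ℕ)) (ZMod 2)) : Diag [b] [a, b, c] :=
  (prepA g a ⊠ wire b ⊠ prepC h c) ⨟ bitCheck B ⨟ crossCheck C ⨟ phaseCheck P

/-- The tripartite CPC decoder `1_a + 1_b + 1_c → 1_b`. -/
def decoder (g h : Color) {a b c : ℕ+} (B : Matrix (Fin (a : ℕ)) (Fin (b : ℕ)) (ZMod 2))
    (P : Matrix (Fin (c : ℕ)) (Fin (b : ℕ)) (ZMod 2))
    (C : Matrix (Fin (c : ℕ)) (Fin (a : ℕ)) (ZMod 2)) : Diag [a, b, c] [b] :=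
  phaseCheck P ⨟ crossCheck C ⨟ bitCheck B ⨟ (testA g a ⊠ wire b ⊠ testC h c)

end CPC

end SZX

end

/-!
Derivability is turned into equality: `Mor` is the type of diagrams modulo derivability, with a
composition `⨾` that is total (an ill-typed composition is the absorbing element `bot`) and a
parallel composition `*` that is a monoid. Since morphisms carry their types as data, the strict
associativity of lists needs no transport. Every diagram is a sequence of layers, one box between
wires, and `simp` with `left_first` brings the layers into a fixed order; the calculations below
alternate such planar isotopies with single rules of the calculus.

The encoder is an isometry because the three couplings are self-adjoint involutions and the two
initial states have norm one.

* `hopf_one`: closing one output of the bialgebra law with a dot gives the Hopf law on a qubit. It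
  implies that a circle is the square of the scalar `√2` (`unit_comp_counit_one`), and the laws of
  the dividers extend it to registers (`hopf`).
* `copy_mt_mt_merge`: by induction on the columns and then on the rows, two copies of a wire that go
  through the same matrix and are added disconnect. Two equal controlled-NOT gates fuse into one
  whose dots are joined by two copies of the matrix, hence cancel (`cn_cn`).
* `mk_dagger_cnot`: bending wires identifies a controlled-NOT gate with its adjoint.
* `mt_ones_mb`, `mb_mt_ones`: the column of ones is an isometry and the row of ones is, up to a
  scalar, a coisometry, whatever the colours of the dots. Hence `prepA_testA` and `prepC_testC`.

All scalars that occur are powers `scal k` of `√2`, a unit of the monoid `Mor`.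
-/

noncomputable section

namespace SZX

/-! ### Diagrams up to derivability -/

/-- A diagram together with its type. -/
abbrev Raw : Type := Σ a b : Ty, Diag a b

instance rawSetoid : Setoid Raw where
  r f g := Derivable f.2.2 g.2.2
  iseqv := ⟨fun f => .refl f.2.2, fun h => h.symm, fun h h' => h.trans h'⟩

/-- Morphisms: diagrams of any type up to derivability, and one additional element, the
value of an ill-typed composition. -/
def Mor : Type := Option (Quotient rawSetoid)

/-- The morphism represented by a diagram. -/
def mk {a b : Ty} (f : Diag a b) : Mor := some ⟦⟨a, b, f⟩⟧

theorem mk_eq_mk {a b a' b' : Ty} {f : Diag a b} {g : Diag a' b'} :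
    mk f = mk g ↔ Derivable f g := by
  constructor
  · intro h
    exact Quotient.exact (Option.some.inj h)
  · intro h
    exact congrArg some (Quotient.sound (a := (⟨a, b, f⟩ : Raw)) (b := ⟨a', b', g⟩) h)

theorem mk_cast {a a' b b' : Ty} (ha : a = a') (hb : b = b') (f : Diag a b) :
    mk (f.cast ha hb) = mk f := by
  subst ha hb; rfl

namespace Mor

/-- The value of an ill-typed composition. -/
def bot : Mor := (Option.none : Option (Quotient rawSetoid))

theorem eq_bot_or_mk (f : Mor) : f = bot ∨ ∃ (a b : Ty) (d : Diag a b), f = mk d := by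
  rcases f with _ | q
  · exact .inl rfl
  · induction q using Quotient.inductionOn with
    | h x => exact .inr ⟨x.1, x.2.1, x.2.2, rfl⟩

/-- The input type. -/
def dm (f : Mor) : Option Ty :=
  Option.map (Quotient.lift (fun x : Raw => x.1) fun _ _ h => (Derivable.types_eq h).1) f

/-- The output type. -/
def cd (f : Mor) : Option Ty :=
  Option.map (Quotient.lift (fun x : Raw => x.2.1) fun _ _ h => (Derivable.types_eq h).2) f

/-- Sequential composition of representatives, `bot` when their types do not match. -/
def rawComp {a b c d : Ty} (f : Diag a b) (g : Diag c d) : Mor :=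
  if h : b = c then mk (f ⨟ g.cast h.symm rfl) else bot

theorem rawComp_self {a b c : Ty} (f : Diag a b) (g : Diag b c) : rawComp f g = mk (f ⨟ g) :=
  dif_pos rfl

theorem rawComp_of_ne {a b c d : Ty} (f : Diag a b) (g : Diag c d) (h : b ≠ c) :
    rawComp f g = bot :=
  dif_neg h

theorem rawComp_congr {a b c d a' b' c' d' : Ty} {f : Diag a b} {g : Diag c d}
    {f' : Diag a' b'} {g' : Diag c' d'} (hf : Derivable f f') (hg : Derivable g g') :
    rawComp f g = rawComp f' g' := by
  obtain ⟨rfl, rfl⟩ := hf.types_eq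
  obtain ⟨rfl, rfl⟩ := hg.types_eq
  by_cases h : b = c
  · subst h
    rw [rawComp_self, rawComp_self]
    exact mk_eq_mk.2 (.comp hf hg)
  · rw [rawComp_of_ne _ _ h, rawComp_of_ne _ _ h]

/-- Sequential composition, in diagrammatic order. -/
def comp : Mor → Mor → Mor
  | some f, some g =>
    Quotient.lift₂ (fun x y : Raw => rawComp x.2.2 y.2.2)
      (fun _ _ _ _ hx hy => rawComp_congr hx hy) f g
  | _, _ => bot

/-- Parallel composition. -/
def tensor : Mor → Mor → Mor
  | some f, some g =>
    Quotient.lift₂ (fun x y : Raw => mk (x.2.2 ⊠ y.2.2))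
      (fun _ _ _ _ hx hy => mk_eq_mk.2 (.tensor hx hy)) f g
  | _, _ => bot

end Mor

open Mor

infixl:65 " ⨾ " => Mor.comp

/-- The identity of a type. -/
def idl (a : Ty) : Mor := mk (Diag.id a)

theorem mk_comp {a b c : Ty} (f : Diag a b) (g : Diag b c) : mk (f ⨟ g) = mk f ⨾ mk g :=
  (rawComp_self f g).symm

theorem mk_comp_of_ne {a b b' c : Ty} (f : Diag a b) (g : Diag b' c) (h : b ≠ b') :
    mk f ⨾ mk g = bot :=
  rawComp_of_ne f g h

instance : Mul Mor := ⟨Mor.tensor⟩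
instance : One Mor := ⟨idl []⟩

theorem mk_tensor {a b c d : Ty} (f : Diag a b) (g : Diag c d) : mk (f ⊠ g) = mk f * mk g := rfl

theorem bot_mul (f : Mor) : bot * f = bot := rfl

theorem mul_bot (f : Mor) : f * bot = bot := by
  rcases f with _ | f <;> rfl

theorem bot_comp (f : Mor) : bot ⨾ f = bot := rfl

theorem comp_bot (f : Mor) : f ⨾ bot = bot := by
  rcases f with _ | f <;> rfl

instance : Monoid Mor where
  mul_assoc f g h := by
    rcases f.eq_bot_or_mk with rfl | ⟨_, _, f, rfl⟩
    · rfl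
    rcases g.eq_bot_or_mk with rfl | ⟨_, _, g, rfl⟩
    · simp only [bot_mul, mul_bot]
    rcases h.eq_bot_or_mk with rfl | ⟨_, _, h, rfl⟩
    · simp only [mul_bot]
    simp only [← mk_tensor]
    exact mk_eq_mk.2 (.tensor_assoc f g h)
  one_mul f := by
    rcases f.eq_bot_or_mk with rfl | ⟨_, _, f, rfl⟩
    · rfl
    exact mk_eq_mk.2 (.empty_tensor f)
  mul_one f := by
    rcases f.eq_bot_or_mk with rfl | ⟨_, _, f, rfl⟩
    · rfl
    exact mk_eq_mk.2 (.tensor_empty f)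

-- The types are computed by unfolding quotients. The proofs `(rfl)` of the equations below keep
-- `simp` from using these as definitional equalities, which fail at reducible transparency.
@[simp] theorem dm_mk {a b : Ty} (f : Diag a b) : dm (mk f) = some a := (rfl)
@[simp] theorem cd_mk {a b : Ty} (f : Diag a b) : cd (mk f) = some b := (rfl)
@[simp] theorem dm_idl (a : Ty) : dm (idl a) = some a := (rfl)
@[simp] theorem cd_idl (a : Ty) : cd (idl a) = some a := (rfl)
@[simp] theorem dm_one : dm 1 = some [] := (rfl)
@[simp] theorem cd_one : cd 1 = some [] := (rfl)

theorem eq_bot_of_dm {f : Mor} (h : dm f = none) : f = bot := by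
  rcases f.eq_bot_or_mk with rfl | ⟨_, _, f, rfl⟩
  · rfl
  · cases h

theorem exists_mk {f g : Mor} (h : cd f = dm g) :
    (f = bot ∧ g = bot) ∨
      ∃ (a b c : Ty) (f' : Diag a b) (g' : Diag b c), f = mk f' ∧ g = mk g' := by
  rcases f.eq_bot_or_mk with rfl | ⟨a, b, f, rfl⟩
  · exact .inl ⟨rfl, eq_bot_of_dm h.symm⟩
  rcases g.eq_bot_or_mk with rfl | ⟨b', c, g, rfl⟩
  · cases h
  obtain rfl : b = b' := Option.some.inj h
  exact .inr ⟨a, b, c, f, g, rfl, rfl⟩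

theorem dm_comp {f g : Mor} (h : cd f = dm g) : dm (f ⨾ g) = dm f := by
  rcases exists_mk h with ⟨rfl, rfl⟩ | ⟨a, b, c, f, g, rfl, rfl⟩
  · rfl
  · rw [← mk_comp]; rfl

theorem cd_comp {f g : Mor} (h : cd f = dm g) : cd (f ⨾ g) = cd g := by
  rcases exists_mk h with ⟨rfl, rfl⟩ | ⟨a, b, c, f, g, rfl, rfl⟩
  · rfl
  · rw [← mk_comp]; rfl

@[simp] theorem dm_mul (f g : Mor) :
    dm (f * g) = Option.map₂ (fun a b => a ++ b) (dm f) (dm g) := by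
  rcases f.eq_bot_or_mk with rfl | ⟨_, _, f, rfl⟩
  · rfl
  rcases g.eq_bot_or_mk with rfl | ⟨_, _, g, rfl⟩
  · rfl
  rfl

@[simp] theorem cd_mul (f g : Mor) :
    cd (f * g) = Option.map₂ (fun a b => a ++ b) (cd f) (cd g) := by
  rcases f.eq_bot_or_mk with rfl | ⟨_, _, f, rfl⟩
  · rfl
  rcases g.eq_bot_or_mk with rfl | ⟨_, _, g, rfl⟩
  · rfl
  rfl

@[simp] theorem dm_comp_eq_ite (f g : Mor) :
    dm (f ⨾ g) = if cd f = dm g then dm f else Option.none := by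
  split
  · next h => exact dm_comp h
  · next h =>
    rcases f.eq_bot_or_mk with rfl | ⟨a, b, f, rfl⟩
    · rfl
    rcases g.eq_bot_or_mk with rfl | ⟨b', c, g, rfl⟩
    · rfl
    rw [mk_comp_of_ne f g fun e => h (congrArg some e)]
    rfl

@[simp] theorem cd_comp_eq_ite (f g : Mor) :
    cd (f ⨾ g) = if cd f = dm g then cd g else Option.none := by
  split
  · next h => exact cd_comp h
  · next h =>
    rcases f.eq_bot_or_mk with rfl | ⟨a, b, f, rfl⟩
    · rfl
    rcases g.eq_bot_or_mk with rfl | ⟨b', c, g, rfl⟩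
    · rfl
    rw [mk_comp_of_ne f g fun e => h (congrArg some e)]
    rfl

theorem comp_assoc (f g h : Mor) : f ⨾ g ⨾ h = f ⨾ (g ⨾ h) := by
  rcases f.eq_bot_or_mk with rfl | ⟨a, b, f, rfl⟩
  · rfl
  rcases g.eq_bot_or_mk with rfl | ⟨b', c, g, rfl⟩
  · simp only [bot_comp, comp_bot]
  rcases h.eq_bot_or_mk with rfl | ⟨c', d, h, rfl⟩
  · simp only [comp_bot]
  by_cases hb : b = b'
  · subst hb
    by_cases hc : c = c'
    · subst hc
      simp only [← mk_comp]
      exact mk_eq_mk.2 (.comp_assoc f g h)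
    · rw [mk_comp_of_ne g h hc, ← mk_comp, mk_comp_of_ne _ h hc, comp_bot]
  · rw [mk_comp_of_ne f g hb]
    by_cases hc : c = c'
    · subst hc
      rw [← mk_comp, mk_comp_of_ne _ _ hb, bot_comp]
    · rw [mk_comp_of_ne g h hc, comp_bot, bot_comp]

theorem idl_comp {a : Ty} {f : Mor} (h : dm f = some a) : idl a ⨾ f = f := by
  rcases f.eq_bot_or_mk with rfl | ⟨_, _, f, rfl⟩
  · rfl
  obtain rfl := Option.some.inj h
  exact (mk_comp _ _).symm.trans (mk_eq_mk.2 (.id_comp f))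

theorem comp_idl {a : Ty} {f : Mor} (h : cd f = some a) : f ⨾ idl a = f := by
  rcases f.eq_bot_or_mk with rfl | ⟨_, _, f, rfl⟩
  · rfl
  obtain rfl := Option.some.inj h
  exact (mk_comp _ _).symm.trans (mk_eq_mk.2 (.comp_id f))

theorem one_comp {f : Mor} (h : dm f = some []) : 1 ⨾ f = f := idl_comp h
theorem comp_one {f : Mor} (h : cd f = some []) : f ⨾ 1 = f := comp_idl h

theorem idl_nil : idl [] = 1 := rfl

theorem idl_mul_idl (a b : Ty) : idl a * idl b = idl (a ++ b) :=
  mk_eq_mk.2 (.id_tensor_id a b)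

theorem mul_comp_mul {f f' g g' : Mor} (h : cd f = dm g) (h' : cd f' = dm g') :
    (f * f') ⨾ (g * g') = (f ⨾ g) * (f' ⨾ g') := by
  rcases exists_mk h with ⟨rfl, rfl⟩ | ⟨a, b, c, f, g, rfl, rfl⟩
  · simp only [bot_mul, bot_comp]
  rcases exists_mk h' with ⟨rfl, rfl⟩ | ⟨a', b', c', f', g', rfl, rfl⟩
  · simp only [mul_bot, bot_comp]
  simp only [← mk_tensor, ← mk_comp]
  exact mk_eq_mk.2 (.interchange f g f' g')

/-! ### Planar isotopy -/

/-- The wire of size `n`. -/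
abbrev w (n : ℕ+) : Mor := idl [n]

/-- The layer of a diagram made of `f`, the wires `a` to its left and the wires `b` to its
right. -/
def lay (a : Ty) (f : Mor) (b : Ty) : Mor := idl a * f * idl b

/-- The list of inputs, empty for an ill-typed composition. -/
def ins (f : Mor) : Ty := (dm f).getD []

/-- The list of outputs, empty for an ill-typed composition. -/
def outs (f : Mor) : Ty := (cd f).getD []

theorem ins_eq {f : Mor} {a : Ty} (h : dm f = some a) : ins f = a := by simp [ins, h]
theorem outs_eq {f : Mor} {a : Ty} (h : cd f = some a) : outs f = a := by simp [outs, h]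

/-- A parallel composition is a sequence of two layers. -/
theorem mul_eq_lay_comp_lay (f g : Mor) : f * g = lay [] f (ins g) ⨾ lay (outs f) g [] := by
  rcases f.eq_bot_or_mk with rfl | ⟨_, _, f, rfl⟩
  · simp only [bot_mul, lay, mul_bot, bot_comp]
  rcases g.eq_bot_or_mk with rfl | ⟨_, _, g, rfl⟩
  · simp only [mul_bot, bot_mul, lay, comp_bot]
  rw [ins_eq rfl, outs_eq rfl]
  simp only [lay, idl_nil, one_mul, mul_one]
  rw [mul_comp_mul (by simp) (by simp), comp_idl (by simp), idl_comp (by simp)]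

theorem lay_comp (a b : Ty) {f g : Mor} (h : cd f = dm g) :
    lay a (f ⨾ g) b = lay a f b ⨾ lay a g b := by
  unfold lay
  rw [mul_comp_mul (by simp [h]) (by simp), mul_comp_mul (by simp) h, comp_idl (by simp),
    comp_idl (by simp)]

theorem lay_lay (a b c d : Ty) (f : Mor) : lay a (lay b f c) d = lay (a ++ b) f (c ++ d) := by
  simp only [lay, ← idl_mul_idl, mul_assoc]

theorem lay_idl (a b c : Ty) : lay a (idl b) c = idl (a ++ b ++ c) := by
  simp only [lay, idl_mul_idl]

theorem lay_nil_nil (f : Mor) : lay [] f [] = f := by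
  simp only [lay, idl_nil, one_mul, mul_one]

@[simp] theorem dm_lay (a : Ty) (f : Mor) (b : Ty) :
    dm (lay a f b) = (dm f).map fun c => a ++ (c ++ b) := by
  unfold lay
  rcases f.eq_bot_or_mk with rfl | ⟨_, _, f, rfl⟩
  · rfl
  · simp

@[simp] theorem cd_lay (a : Ty) (f : Mor) (b : Ty) :
    cd (lay a f b) = (cd f).map fun c => a ++ (c ++ b) := by
  unfold lay
  rcases f.eq_bot_or_mk with rfl | ⟨_, _, f, rfl⟩
  · rfl
  · simp

/-- Two diagrams side by side can be performed in either order. -/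
theorem lay_comp_lay (a x b : Ty) (f g : Mor) :
    lay (a ++ ins g ++ x) f b ⨾ lay a g (x ++ outs f ++ b) =
      lay a g (x ++ ins f ++ b) ⨾ lay (a ++ outs g ++ x) f b := by
  rcases f.eq_bot_or_mk with rfl | ⟨_, _, f, rfl⟩
  · simp only [lay, mul_bot, bot_mul, bot_comp, comp_bot]
  rcases g.eq_bot_or_mk with rfl | ⟨_, _, g, rfl⟩
  · simp only [lay, mul_bot, bot_mul, bot_comp, comp_bot]
  simp only [ins_eq (dm_mk _), outs_eq (cd_mk _), lay, ← idl_mul_idl, mul_assoc]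
  rw [mul_comp_mul (by simp) (by simp), mul_comp_mul (by simp) (by simp),
    mul_comp_mul (by simp) (by simp), mul_comp_mul (by simp) (by simp),
    mul_comp_mul (by simp) (by simp), mul_comp_mul (by simp) (by simp),
    idl_comp (f := mk g) (by simp), comp_idl (f := mk g) (by simp),
    mul_comp_mul (by simp) (by simp), mul_comp_mul (by simp) (by simp),
    idl_comp (f := mk f) (by simp), comp_idl (f := mk f) (by simp)]

/-- A layer whose box `g` lies to the left of the box `f` of the previous layer goes first. As a
rewriting rule, together with the variants below for a layer that is followed by others or has no
wires beside its box, this serves to bring diagrams that are equal up to planar isotopy to the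
same sequence of layers. The last hypothesis stops the rule from exchanging two boxes forever. -/
theorem left_first {a b c d : Ty} {f g : Mor}
    (h₁ : c.length + (ins g).length ≤ a.length)
    (h₂ : c ++ (ins g ++ d) = a ++ (outs f ++ b))
    (_h₃ : c.length < a.length ∨ outs f ≠ []) :
    lay a f b ⨾ lay c g d =
      lay c g (a.drop (c.length + (ins g).length) ++ (ins f ++ b)) ⨾
        lay (c ++ (outs g ++ a.drop (c.length + (ins g).length))) f b := by
  obtain ⟨x, rfl⟩ : ∃ x, a = c ++ ins g ++ x := by
    have h := congrArg (List.take (c.length + (ins g).length)) h₂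
    rw [← List.append_assoc, List.take_append_of_le_length (by simp),
      List.take_append_of_le_length h₁, List.take_of_length_le (by simp)] at h
    exact ⟨a.drop (c.length + (ins g).length), by rw [h, List.take_append_drop]⟩
  have hd : d = x ++ outs f ++ b := by simpa using h₂
  subst hd
  have hx : (c ++ ins g ++ x).drop (c.length + (ins g).length) = x := by
    rw [← List.length_append, List.drop_left]
  rw [hx, lay_comp_lay]
  simp only [List.append_assoc]

theorem left_first_assoc {a b c d : Ty} {f g : Mor} (k : Mor)
    (h₁ : c.length + (ins g).length ≤ a.length)
    (h₂ : c ++ (ins g ++ d) = a ++ (outs f ++ b))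
    (h₃ : c.length < a.length ∨ outs f ≠ []) :
    lay a f b ⨾ (lay c g d ⨾ k) =
      lay c g (a.drop (c.length + (ins g).length) ++ (ins f ++ b)) ⨾
        (lay (c ++ (outs g ++ a.drop (c.length + (ins g).length))) f b ⨾ k) := by
  rw [← comp_assoc, left_first h₁ h₂ h₃, comp_assoc]

theorem left_first_top {d : Ty} {f g : Mor} (h₁ : ins g = []) (h₂ : d = outs f)
    (h₃ : outs f ≠ []) : f ⨾ lay [] g d = lay [] g (ins f) ⨾ lay (outs g) f [] := by
  have h := left_first (a := []) (b := []) (c := []) (d := d) (f := f) (g := g) (by simp [h₁])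
    (by simp [h₁, h₂]) (.inr h₃)
  rw [lay_nil_nil] at h
  simpa using h

theorem left_first_top_assoc {d : Ty} {f g : Mor} (k : Mor) (h₁ : ins g = []) (h₂ : d = outs f)
    (h₃ : outs f ≠ []) :
    f ⨾ (lay [] g d ⨾ k) = lay [] g (ins f) ⨾ (lay (outs g) f [] ⨾ k) := by
  rw [← comp_assoc, left_first_top h₁ h₂ h₃, comp_assoc]

theorem left_first_bot {a : Ty} {f g : Mor} (h₁ : a = ins g) (h₂ : outs f = [])
    (h₃ : ins g ≠ []) : lay a f [] ⨾ g = lay [] g (ins f) ⨾ lay (outs g) f [] := by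
  have h := left_first (a := a) (b := []) (c := []) (d := []) (f := f) (g := g) (by simp [h₁])
    (by simp [h₁, h₂]) (.inl (by subst h₁; exact List.length_pos_iff.2 h₃))
  rw [lay_nil_nil] at h
  subst h₁
  simpa using h

theorem left_first_bot_assoc {a : Ty} {f g : Mor} (k : Mor) (h₁ : a = ins g) (h₂ : outs f = [])
    (h₃ : ins g ≠ []) :
    lay a f [] ⨾ (g ⨾ k) = lay [] g (ins f) ⨾ (lay (outs g) f [] ⨾ k) := by
  rw [← comp_assoc, left_first_bot h₁ h₂ h₃, comp_assoc]

/-! ### The generators -/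

/-- The phase-free spider `k_n → l_n`. -/
def sp (c : Color) (n : ℕ+) (k l : ℕ) : Mor := mk (Diag.spider0 c n k l)
/-- The swap. -/
def sw (n m : ℕ+) : Mor := mk (Diag.swap n m)
/-- The cup. -/
def cup (n : ℕ+) : Mor := mk (Diag.cup n)
/-- The cap. -/
def cap (n : ℕ+) : Mor := mk (Diag.cap n)
/-- The divider `1_{1+n} → 1_1 + 1_n`. -/
def dv (n : ℕ+) : Mor := mk (Diag.divide n)
/-- The gatherer `1_1 + 1_n → 1_{1+n}`. -/
def ga (n : ℕ+) : Mor := mk (Diag.gather n)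
/-- The matrix `A`. -/
def mt {m n : ℕ+} (A : Matrix (Fin (m : ℕ)) (Fin (n : ℕ)) (ZMod 2)) : Mor := mk (Diag.mat A)

@[simp] theorem dm_sp (c : Color) (n : ℕ+) (k l : ℕ) :
    dm (sp c n k l) = some (List.replicate k n) := (rfl)
@[simp] theorem cd_sp (c : Color) (n : ℕ+) (k l : ℕ) :
    cd (sp c n k l) = some (List.replicate l n) := (rfl)
@[simp] theorem dm_sw (n m : ℕ+) : dm (sw n m) = some [n, m] := (rfl)
@[simp] theorem cd_sw (n m : ℕ+) : cd (sw n m) = some [m, n] := (rfl)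
@[simp] theorem dm_cup (n : ℕ+) : dm (cup n) = some [] := (rfl)
@[simp] theorem cd_cup (n : ℕ+) : cd (cup n) = some [n, n] := (rfl)
@[simp] theorem dm_cap (n : ℕ+) : dm (cap n) = some [n, n] := (rfl)
@[simp] theorem cd_cap (n : ℕ+) : cd (cap n) = some [] := (rfl)
@[simp] theorem dm_dv (n : ℕ+) : dm (dv n) = some [1 + n] := by rw [add_comm]; rfl
@[simp] theorem cd_dv (n : ℕ+) : cd (dv n) = some [1, n] := (rfl)
@[simp] theorem dm_ga (n : ℕ+) : dm (ga n) = some [1, n] := (rfl)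
@[simp] theorem cd_ga (n : ℕ+) : cd (ga n) = some [1 + n] := by rw [add_comm]; rfl
@[simp] theorem dm_mt {m n : ℕ+} (A : Matrix (Fin (m : ℕ)) (Fin (n : ℕ)) (ZMod 2)) :
    dm (mt A) = some [n] := (rfl)
@[simp] theorem cd_mt {m n : ℕ+} (A : Matrix (Fin (m : ℕ)) (Fin (n : ℕ)) (ZMod 2)) :
    cd (mt A) = some [m] := (rfl)

-- With these rules `simp` proves equality up to planar isotopy: diagrams become sequences of layers,
-- and boxes further to the left go first. The order is not unique where an effect meets a state at
-- the same position; such diagrams are rearranged by `mul_comp_mul`.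
attribute [simp] mul_eq_lay_comp_lay lay_comp lay_lay lay_idl idl_comp comp_idl comp_assoc ins outs
  List.replicate_succ left_first left_first_assoc lay_nil_nil
  left_first_top left_first_top_assoc left_first_bot left_first_bot_assoc

/-! ### Swaps and scalars -/

theorem sw_sw (n m : ℕ+) : sw n m ⨾ sw m n = idl [n, m] :=
  (mk_comp _ _).symm.trans (mk_eq_mk.2 (.swap_swap n m))

/-- The wire `n` crossing the wires `a` from left to right. -/
def br (n : ℕ+) (a : Ty) : Mor := mk (Diag.braid n a)

theorem br_nil (n : ℕ+) : br n [] = w n := rfl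

theorem br_cons (n m : ℕ+) (a : Ty) :
    br n (m :: a) = (sw n m * idl a) ⨾ (w m * br n a) := mk_comp _ _

@[simp] theorem dm_br (n : ℕ+) (a : Ty) : dm (br n a) = some (n :: a) := (rfl)
@[simp] theorem cd_br (n : ℕ+) (a : Ty) : cd (br n a) = some (a ++ [n]) := (rfl)

theorem br_singleton (n m : ℕ+) : br n [m] = sw n m := by
  rw [br_cons, br_nil]; simp

theorem br_pair (n m k : ℕ+) : br n [m, k] = (sw n m * w k) ⨾ (w m * sw n k) := by
  rw [br_cons, br_singleton]

theorem br_natural (n : ℕ+) {a b : Ty} {f : Mor} (ha : dm f = some a) (hb : cd f = some b) :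
    (w n * f) ⨾ br n b = br n a ⨾ (f * w n) := by
  rcases f.eq_bot_or_mk with rfl | ⟨_, _, f, rfl⟩
  · cases ha
  rw [dm_mk, Option.some_inj] at ha
  rw [cd_mk, Option.some_inj] at hb
  subst ha hb
  simp only [br, w, idl, ← mk_tensor, ← mk_comp]
  exact mk_eq_mk.2 (.swap_natural n f)

/-- A morphism without inputs and outputs. -/
class Scalar (s : Mor) : Prop where
  dm_eq : dm s = some []
  cd_eq : cd s = some []

/-- Scalars pass through wires, by naturality of the swap. -/
theorem scalar_mul_idl (s : Mor) [hs : Scalar s] (a : Ty) : s * idl a = idl a * s := by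
  induction a with
  | nil => rw [idl_nil, one_mul, mul_one]
  | cons n a ih =>
    have h := br_natural n hs.dm_eq hs.cd_eq
    rw [br_nil, comp_idl (by simp only [cd_mul, cd_idl, hs.cd_eq]; rfl),
      idl_comp (by simp only [dm_mul, dm_idl, hs.dm_eq]; rfl)] at h
    rw [← List.singleton_append, ← idl_mul_idl, ← mul_assoc, ← h, mul_assoc, ih, mul_assoc]

theorem scalar_mul_comm (s : Mor) [hs : Scalar s] (f : Mor) : s * f = f * s := by
  rcases f.eq_bot_or_mk with rfl | ⟨a, b, f, rfl⟩
  · rw [mul_bot, bot_mul]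
  calc s * mk f = (s ⨾ 1) * (idl a ⨾ mk f) := by
        rw [comp_one hs.cd_eq, idl_comp (by simp)]
    _ = (s * idl a) ⨾ (1 * mk f) := (mul_comp_mul (by simp [hs.cd_eq]) (by simp)).symm
    _ = (idl a * s) ⨾ (mk f * 1) := by rw [scalar_mul_idl, one_mul, mul_one]
    _ = (idl a ⨾ mk f) * (s ⨾ 1) := mul_comp_mul (by simp) (by simp [hs.cd_eq])
    _ = mk f * s := by rw [comp_one hs.cd_eq, idl_comp (by simp)]

theorem mul_scalar_mul (f s : Mor) [Scalar s] (g : Mor) : f * (s * g) = s * (f * g) := by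
  rw [← mul_assoc, ← scalar_mul_comm s f, mul_assoc]

theorem scalar_mul_comp (s : Mor) [hs : Scalar s] (f g : Mor) : (s * f) ⨾ g = s * (f ⨾ g) := by
  rcases f.eq_bot_or_mk with rfl | ⟨a, b, f, rfl⟩
  · rw [mul_bot, bot_comp, mul_bot]
  rcases g.eq_bot_or_mk with rfl | ⟨b', c, g, rfl⟩
  · rw [comp_bot, comp_bot, mul_bot]
  by_cases h : b = b'
  · subst h
    conv_lhs => rw [← one_mul (mk g)]
    rw [mul_comp_mul (by simp [hs.cd_eq]) (by simp), comp_one hs.cd_eq]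
  · obtain ⟨x, y, t, rfl⟩ := s.eq_bot_or_mk.resolve_left (by rintro rfl; cases hs.dm_eq)
    have hy : y = [] := Option.some.inj hs.cd_eq
    subst hy
    rw [mk_comp_of_ne f g h, ← mk_tensor, mk_comp_of_ne _ g h, mul_bot]

theorem comp_scalar_mul (s : Mor) [hs : Scalar s] (f g : Mor) : f ⨾ (s * g) = s * (f ⨾ g) := by
  rcases f.eq_bot_or_mk with rfl | ⟨a, b, f, rfl⟩
  · rw [bot_comp, bot_comp, mul_bot]
  rcases g.eq_bot_or_mk with rfl | ⟨b', c, g, rfl⟩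
  · rw [mul_bot, comp_bot, mul_bot]
  by_cases h : b = b'
  · subst h
    conv_lhs => rw [← one_mul (mk f)]
    rw [mul_comp_mul (by simp [hs.dm_eq]) (by simp), one_comp hs.dm_eq]
  · obtain ⟨x, y, t, rfl⟩ := s.eq_bot_or_mk.resolve_left (by rintro rfl; cases hs.dm_eq)
    have hx : x = [] := Option.some.inj hs.dm_eq
    subst hx
    rw [mk_comp_of_ne f g h, ← mk_tensor, mk_comp_of_ne f _ h, mul_bot]

instance : Scalar 1 := ⟨rfl, rfl⟩

instance (s t : Mor) [hs : Scalar s] [ht : Scalar t] : Scalar (s * t) :=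
  ⟨by simp only [dm_mul, hs.dm_eq, ht.dm_eq]; rfl, by simp only [cd_mul, hs.cd_eq, ht.cd_eq]; rfl⟩

/-! ### Spiders, cups and caps -/

theorem bend_in (c : Color) (n : ℕ+) (k l : ℕ) :
    sp c n (k + 1) l =
      (w n * sp c n k (l + 1)) ⨾ (cap n * idl (List.replicate l n)) :=
  (mk_eq_mk.2 (.spider_bend_in c n k l 0)).trans (mk_comp _ _)

theorem bend_out (c : Color) (n : ℕ+) (k l : ℕ) :
    sp c n k (l + 1) =
      (cup n * idl (List.replicate k n)) ⨾ (w n * sp c n (k + 1) l) :=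
  (mk_eq_mk.2 (.spider_bend_out c n k l 0)).trans (mk_comp _ _)

/-- Fusion of two spiders along `m + 1` wires. -/
theorem fusion (c : Color) (n : ℕ+) (k k' l l' m : ℕ) :
    (sp c n k (l + (m + 1)) * idl (List.replicate k' n)) ⨾
        (idl (List.replicate l n) * sp c n ((m + 1) + k') l') =
      sp c n (k + k') (l + l') := by
  have h := mk_eq_mk.2 (Derivable.fusion c n k k' l l' m 0 0)
  rw [mk_comp, mk_cast, add_zero] at h
  exact h

theorem sp_swap_out (c : Color) (n : ℕ+) (k i j : ℕ) :
    sp c n k (i + (2 + j)) ⨾ (idl (List.replicate i n) * sw n n * idl (List.replicate j n)) =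
      sp c n k (i + (2 + j)) := by
  have h := mk_eq_mk.2 (Derivable.spider_swap_out c n k i j 0)
  rw [mk_comp, mk_cast] at h
  rw [mul_assoc]
  exact h

theorem sp_swap_in (c : Color) (n : ℕ+) (i j l : ℕ) :
    (idl (List.replicate i n) * sw n n * idl (List.replicate j n)) ⨾ sp c n (i + (2 + j)) l =
      sp c n (i + (2 + j)) l := by
  have h := mk_eq_mk.2 (Derivable.spider_swap_in c n i j l 0)
  rw [mk_comp, mk_cast] at h
  rw [mul_assoc]
  exact h

theorem sp_id (c : Color) (n : ℕ+) : sp c n 1 1 = w n := mk_eq_mk.2 (.spider_id c n)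

theorem snake (n : ℕ+) : (cup n * w n) ⨾ (w n * cap n) = w n :=
  (mk_comp _ _).symm.trans (mk_eq_mk.2 (.snake n))

theorem snake' (n : ℕ+) : (w n * cup n) ⨾ (cap n * w n) = w n :=
  (mk_comp _ _).symm.trans (mk_eq_mk.2 (.snake' n))

theorem sp_cup (c : Color) (n : ℕ+) : sp c n 0 2 = cup n := by
  rw [bend_out c n 0 1, sp_id]; simp

theorem sp_cap (c : Color) (n : ℕ+) : sp c n 2 0 = cap n := by
  rw [bend_in c n 1 0, sp_id]; simp

theorem copy_sw (c : Color) (n : ℕ+) : sp c n 1 2 ⨾ sw n n = sp c n 1 2 := by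
  have h := sp_swap_out c n 1 0 0
  simp only [List.replicate_zero, idl_nil, one_mul, mul_one] at h
  exact h

theorem sw_merge (c : Color) (n : ℕ+) : sw n n ⨾ sp c n 2 1 = sp c n 2 1 := by
  have h := sp_swap_in c n 0 0 1
  simp only [List.replicate_zero, idl_nil, one_mul, mul_one] at h
  exact h

theorem cup_sw (n : ℕ+) : cup n ⨾ sw n n = cup n :=
  (mk_comp _ _).symm.trans (mk_eq_mk.2 (.cup_swap n))

theorem sw_cap (n : ℕ+) : sw n n ⨾ cap n = cap n :=
  (mk_comp _ _).symm.trans (mk_eq_mk.2 (.swap_cap n))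

section

variable (c : Color) (n : ℕ+)

theorem copy_right : sp c n 1 2 ⨾ (w n * sp c n 1 2) = sp c n 1 3 := by
  have h := fusion c n 1 0 1 2 0
  simp only [List.replicate_zero, idl_nil, mul_one] at h
  exact h

theorem merge_left : (sp c n 2 1 * w n) ⨾ sp c n 2 1 = sp c n 3 1 := by
  have h := fusion c n 2 1 0 1 0
  simp only [List.replicate_zero, idl_nil, one_mul] at h
  exact h

theorem copy_counit_right : sp c n 1 2 ⨾ (w n * sp c n 1 0) = w n := by
  have h := fusion c n 1 0 1 0 0
  simp only [List.replicate_zero, idl_nil, mul_one] at h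
  exact h.trans (sp_id c n)

theorem unit_merge_left : (sp c n 0 1 * w n) ⨾ sp c n 2 1 = w n := by
  have h := fusion c n 0 1 0 1 0
  simp only [List.replicate_zero, idl_nil, one_mul] at h
  exact h.trans (sp_id c n)

theorem copy_merge : sp c n 1 2 ⨾ sp c n 2 1 = w n := by
  have h := fusion c n 1 0 0 1 1
  simp only [List.replicate_zero, idl_nil, one_mul, mul_one] at h
  exact h.trans (sp_id c n)

theorem unit_copy : sp c n 0 1 ⨾ sp c n 1 2 = cup n := by
  have h := fusion c n 0 0 0 2 0
  simp only [List.replicate_zero, idl_nil, one_mul, mul_one] at h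
  exact h.trans (sp_cup c n)

theorem merge_counit : sp c n 2 1 ⨾ sp c n 1 0 = cap n := by
  have h := fusion c n 2 0 0 0 0
  simp only [List.replicate_zero, idl_nil, one_mul, mul_one] at h
  exact h.trans (sp_cap c n)

theorem copy_cap : sp c n 1 2 ⨾ cap n = sp c n 1 0 := by
  have h := fusion c n 1 0 0 0 1
  simp only [List.replicate_zero, idl_nil, one_mul, mul_one] at h
  rw [← sp_cap c n]
  exact h

/-- Bending the second output of the copy to the right. -/
theorem copy_bend_right : (sp c n 1 2 * w n) ⨾ (w n * cap n) = sp c n 2 1 := by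
  have h := fusion c n 1 1 1 0 0
  rw [← sp_cap c n]
  exact h

/-- Bending the first output of the copy to the left. -/
theorem copy_bend_left : (w n * sp c n 1 2) ⨾ (cap n * w n) = sp c n 2 1 :=
  (bend_in c n 1 1).symm

/-- Bending the first input of the merge to the left. -/
theorem merge_bend_left : (cup n * w n) ⨾ (w n * sp c n 2 1) = sp c n 1 2 :=
  (bend_out c n 1 1).symm

theorem unit_cap : (w n * sp c n 0 1) ⨾ cap n = sp c n 1 0 := by
  have h := (bend_in c n 0 0).symm
  simp only [List.replicate_zero, idl_nil, mul_one] at h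
  exact h

end

/-- The wire `n` crossing the wires `a` from right to left. -/
def rb : (a : Ty) → ℕ+ → Mor
  | [], n => w n
  | m :: a, n => (w m * rb a n) ⨾ (sw m n * idl a)

theorem rb_singleton (n m : ℕ+) : rb [m] n = sw m n := by
  simp [rb]

theorem rb_pair (n m k : ℕ+) : rb [m, k] n = (w m * sw k n) ⨾ (sw m n * w k) := by
  rw [rb, rb_singleton]

@[simp] theorem dm_rb_and_cd_rb (a : Ty) (n : ℕ+) : dm (rb a n) = some (a ++ [n]) ∧
    cd (rb a n) = some (n :: a) := by
  induction a with
  | nil => exact ⟨rfl, rfl⟩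
  | cons m a ih => simp [rb, ih]

theorem rb_br (a : Ty) (n : ℕ+) : rb a n ⨾ br n a = idl (a ++ [n]) := by
  induction a with
  | nil => simp [rb, br_nil]
  | cons m a ih =>
    rw [rb, br_cons, comp_assoc, ← comp_assoc (sw m n * idl a), mul_comp_mul (by simp) (by simp),
      sw_sw, comp_idl (by simp), idl_mul_idl, idl_comp (by simp),
      mul_comp_mul (by simp) (by simp [dm_rb_and_cd_rb]), ih, comp_idl (by simp), idl_mul_idl]
    rfl

theorem br_rb (a : Ty) (n : ℕ+) : br n a ⨾ rb a n = idl (n :: a) := by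
  induction a with
  | nil => simp [rb, br_nil]
  | cons m a ih =>
    rw [rb, br_cons, comp_assoc, ← comp_assoc (w m * br n a),
      mul_comp_mul (by simp) (by simp [dm_rb_and_cd_rb]), ih, comp_idl (by simp), idl_mul_idl,
      idl_comp (by simp), mul_comp_mul (by simp) (by simp), sw_sw, comp_idl (by simp),
      idl_mul_idl]
    rfl

theorem rb_natural (n : ℕ+) {a b : Ty} {f : Mor} (ha : dm f = some a) (hb : cd f = some b) :
    (f * w n) ⨾ rb b n = rb a n ⨾ (w n * f) := by
  calc (f * w n) ⨾ rb b n = rb a n ⨾ (br n a ⨾ (f * w n)) ⨾ rb b n := by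
        rw [← comp_assoc, rb_br, idl_comp (by simp [ha, -mul_eq_lay_comp_lay])]
    _ = rb a n ⨾ (w n * f) := by
        rw [← br_natural n ha hb, comp_assoc, comp_assoc, br_rb,
          comp_idl (by simp [hb, -mul_eq_lay_comp_lay])]

section

variable (n : ℕ+) {a b c : ℕ+} {f : Mor}

/-- Naturality of the swap for a box on the right wire, which moves to the left. The primed versions
are for a box that moves to the right; the names of the variants for other boxes give the numbers
of inputs and outputs of the box. -/
theorem sw_nat (ha : dm f = some [a]) (hb : cd f = some [b]) :
    (w n * f) ⨾ sw n b = sw n a ⨾ (f * w n) := by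
  rw [← br_singleton, ← br_singleton, br_natural n ha hb]

theorem sw_nat' (ha : dm f = some [a]) (hb : cd f = some [b]) :
    (f * w n) ⨾ sw b n = sw a n ⨾ (w n * f) := by
  rw [← rb_singleton, ← rb_singleton, rb_natural n ha hb]

theorem sw_nat_one_two (ha : dm f = some [a]) (hb : cd f = some [b, c]) :
    (w n * f) ⨾ (sw n b * w c) ⨾ (w b * sw n c) = sw n a ⨾ (f * w n) := by
  rw [← br_singleton n a, ← br_natural n ha hb, br_pair, comp_assoc]

theorem sw_nat_two_one (ha : dm f = some [a, b]) (hb : cd f = some [c]) :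
    (w n * f) ⨾ sw n c = (sw n a * w b) ⨾ (w a * sw n b) ⨾ (f * w n) := by
  rw [← br_singleton n c, br_natural n ha hb, br_pair]

theorem sw_nat_zero_one (ha : dm f = some []) (hb : cd f = some [b]) :
    (w n * f) ⨾ sw n b = f * w n := by
  rw [← br_singleton n b, br_natural n ha hb, br_nil,
    idl_comp (by simp [ha, -mul_eq_lay_comp_lay])]

theorem sw_nat_one_zero (ha : dm f = some [a]) (hb : cd f = some []) :
    sw n a ⨾ (f * w n) = w n * f := by
  rw [← br_singleton n a, ← br_natural n ha hb, br_nil,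
    comp_idl (by simp [hb, -mul_eq_lay_comp_lay])]

theorem sw_nat_two_zero (ha : dm f = some [a, b]) (hb : cd f = some []) :
    (sw n a * w b) ⨾ (w a * sw n b) ⨾ (f * w n) = w n * f := by
  rw [← br_pair n a, ← br_natural n ha hb, br_nil,
    comp_idl (by simp [hb, -mul_eq_lay_comp_lay])]

theorem sw_nat_zero_two (ha : dm f = some []) (hb : cd f = some [b, c]) :
    (w n * f) ⨾ (sw n b * w c) ⨾ (w b * sw n c) = f * w n := by
  rw [comp_assoc, ← br_pair n b, br_natural n ha hb, br_nil,
    idl_comp (by simp [ha, -mul_eq_lay_comp_lay])]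

theorem sw_nat_zero_two' (ha : dm f = some []) (hb : cd f = some [b, c]) :
    (f * w n) ⨾ (w b * sw c n) ⨾ (sw b n * w c) = w n * f := by
  rw [comp_assoc, ← rb_pair n b, rb_natural n ha hb, rb,
    idl_comp (by simp [ha, -mul_eq_lay_comp_lay])]

end

section

variable (c : Color) (n : ℕ+)

theorem copy_left : sp c n 1 2 ⨾ (sp c n 1 2 * w n) = sp c n 1 3 := by
  calc sp c n 1 2 ⨾ (sp c n 1 2 * w n) = (sp c n 1 2 ⨾ sw n n) ⨾ (sp c n 1 2 * w n) := by
        rw [copy_sw]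
    _ = sp c n 1 2 ⨾ (w n * sp c n 1 2) ⨾ (sw n n * w n) ⨾ (w n * sw n n) := by
        rw [comp_assoc, ← sw_nat_one_two n (dm_sp ..) (cd_sp ..)]
        simp only [comp_assoc]
    _ = sp c n 1 3 := by
        have h₁ := sp_swap_out c n 1 0 1
        have h₂ := sp_swap_out c n 1 1 0
        simp only [List.replicate_zero, idl_nil, one_mul, mul_one] at h₁ h₂
        rw [copy_right]
        exact (congrArg (· ⨾ (w n * sw n n)) h₁).trans h₂

theorem merge_right : (w n * sp c n 2 1) ⨾ sp c n 2 1 = sp c n 3 1 := by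
  calc (w n * sp c n 2 1) ⨾ sp c n 2 1 = (w n * sp c n 2 1) ⨾ (sw n n ⨾ sp c n 2 1) := by
        rw [sw_merge]
    _ = (sw n n * w n) ⨾ ((w n * sw n n) ⨾ ((sp c n 2 1 * w n) ⨾ sp c n 2 1)) := by
        rw [← comp_assoc, sw_nat_two_one n (dm_sp ..) (cd_sp ..)]
        simp only [comp_assoc]
    _ = sp c n 3 1 := by
        have h₁ := sp_swap_in c n 0 1 1
        have h₂ := sp_swap_in c n 1 0 1
        simp only [List.replicate_zero, idl_nil, one_mul, mul_one] at h₁ h₂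
        rw [merge_left]
        exact (congrArg ((sw n n * w n) ⨾ ·) h₂).trans h₁

theorem copy_assoc :
    sp c n 1 2 ⨾ (sp c n 1 2 * w n) = sp c n 1 2 ⨾ (w n * sp c n 1 2) := by
  rw [copy_left, copy_right]

theorem merge_assoc :
    (sp c n 2 1 * w n) ⨾ sp c n 2 1 = (w n * sp c n 2 1) ⨾ sp c n 2 1 := by
  rw [merge_left, merge_right]

theorem copy_counit_left : sp c n 1 2 ⨾ (sp c n 1 0 * w n) = w n := by
  rw [← copy_sw, comp_assoc, sw_nat_one_zero n (dm_sp ..) (cd_sp ..), copy_counit_right]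

theorem unit_merge_right : (w n * sp c n 0 1) ⨾ sp c n 2 1 = w n := by
  rw [← sw_merge, ← comp_assoc, sw_nat_zero_one n (dm_sp ..) (cd_sp ..), unit_merge_left]

/-- The four outputs of two levels of copies can be exchanged. -/
theorem copy_shuffle :
    sp c n 1 2 ⨾ (sp c n 1 2 * sp c n 1 2) ⨾ (w n * sw n n * w n) =
      sp c n 1 2 ⨾ (sp c n 1 2 * sp c n 1 2) := by
  have h : sp c n 1 2 ⨾ (sp c n 1 2 * sp c n 1 2) =
      sp c n 1 2 ⨾ (w n * (sp c n 1 2 ⨾ (sp c n 1 2 * w n))) := by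
    calc sp c n 1 2 ⨾ (sp c n 1 2 * sp c n 1 2)
        = (sp c n 1 2 ⨾ (sp c n 1 2 * w n)) ⨾ (w n * w n * sp c n 1 2) := by simp
      _ = sp c n 1 2 ⨾ (w n * (sp c n 1 2 ⨾ (w n * sp c n 1 2))) := by
          rw [copy_assoc]; simp
      _ = _ := by rw [copy_assoc]
  rw [h]
  calc sp c n 1 2 ⨾ (w n * (sp c n 1 2 ⨾ (sp c n 1 2 * w n))) ⨾ (w n * sw n n * w n)
      = sp c n 1 2 ⨾ (w n * (sp c n 1 2 ⨾ ((sp c n 1 2 ⨾ sw n n) * w n))) := by simp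
    _ = _ := by rw [copy_sw]

/-- The four inputs of two levels of merges can be exchanged. -/
theorem merge_shuffle :
    (w n * sw n n * w n) ⨾ (sp c n 2 1 * sp c n 2 1) ⨾ sp c n 2 1 =
      (sp c n 2 1 * sp c n 2 1) ⨾ sp c n 2 1 := by
  have h : (sp c n 2 1 * sp c n 2 1) ⨾ sp c n 2 1 =
      (w n * ((sp c n 2 1 * w n) ⨾ sp c n 2 1)) ⨾ sp c n 2 1 := by
    calc (sp c n 2 1 * sp c n 2 1) ⨾ sp c n 2 1
        = (w n * w n * sp c n 2 1) ⨾ ((sp c n 2 1 * w n) ⨾ sp c n 2 1) := by simp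
      _ = (w n * ((w n * sp c n 2 1) ⨾ sp c n 2 1)) ⨾ sp c n 2 1 := by
          rw [merge_assoc]; simp
      _ = _ := by rw [merge_assoc]
  rw [comp_assoc, h]
  calc (w n * sw n n * w n) ⨾ ((w n * ((sp c n 2 1 * w n) ⨾ sp c n 2 1)) ⨾ sp c n 2 1)
      = (w n * (((sw n n ⨾ sp c n 2 1) * w n) ⨾ sp c n 2 1)) ⨾ sp c n 2 1 := by simp
    _ = _ := by rw [sw_merge]

theorem merge_cap : (sp c n 2 1 * w n) ⨾ cap n = (w n * sp c n 2 1) ⨾ cap n := by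
  rw [← merge_counit c, ← comp_assoc, merge_assoc, comp_assoc]

theorem cup_copy : cup n ⨾ (sp c n 1 2 * w n) = cup n ⨾ (w n * sp c n 1 2) := by
  rw [← unit_copy c, comp_assoc, copy_assoc, comp_assoc]

theorem merge_bend_right : (w n * cup n) ⨾ (sp c n 2 1 * w n) = sp c n 1 2 := by
  calc (w n * cup n) ⨾ (sp c n 2 1 * w n)
      = (cup n * w n) ⨾ (w n * sw n n) ⨾ ((sw n n ⨾ sp c n 2 1) * w n) := by
        rw [← sw_nat_zero_two' n (dm_cup n) (cd_cup n)]; simp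
    _ = ((cup n ⨾ sw n n) * w n) ⨾ (w n * sw n n) ⨾ (sp c n 2 1 * w n) := by
        rw [sw_merge, cup_sw]
    _ = (cup n * w n) ⨾ ((sw n n * w n) ⨾ (w n * sw n n) ⨾ (sp c n 2 1 * w n)) := by simp
    _ = (cup n * w n) ⨾ (w n * sp c n 2 1) ⨾ sw n n := by
        rw [← sw_nat_two_one n (dm_sp ..) (cd_sp ..), comp_assoc]
    _ = sp c n 1 2 := by rw [merge_bend_left, copy_sw]

/-- Copying two wires and connecting the copies in pairs is the same as connecting the wires. -/
theorem copy_copy_caps :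
    (sp c n 1 2 * sp c n 1 2) ⨾ (w n * sw n n * w n) ⨾ (cap n * cap n) = cap n := by
  calc (sp c n 1 2 * sp c n 1 2) ⨾ (w n * sw n n * w n) ⨾ (cap n * cap n)
      = (((sp c n 1 2 ⨾ sw n n) * sp c n 1 2) ⨾ (w n * sw n n * w n)) ⨾ (cap n * cap n) := by
        rw [copy_sw]
    _ = (sp c n 1 2 * sp c n 1 2) ⨾
          (((sw n n * w n) ⨾ (w n * sw n n) ⨾ (cap n * w n)) * w n) ⨾ cap n := by simp
    _ = (sp c n 1 2 * sp c n 1 2) ⨾ (w n * cap n * w n) ⨾ cap n := by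
        rw [sw_nat_two_zero n (dm_cap n) (cd_cap n)]
    _ = (w n * sp c n 1 2) ⨾ (((sp c n 1 2 * w n) ⨾ (w n * cap n)) * w n) ⨾ cap n := by simp
    _ = (w n * sp c n 1 2) ⨾ ((sp c n 2 1 * w n) ⨾ cap n) := by
        rw [copy_bend_right, comp_assoc]
    _ = (w n * (sp c n 1 2 ⨾ sp c n 2 1)) ⨾ cap n := by
        rw [merge_cap]; simp
    _ = cap n := by rw [copy_merge]; simp

/-- Two cups merged in parallel form one cup. -/
theorem cups_merge_merge :
    (cup n * cup n) ⨾ (w n * sw n n * w n) ⨾ (sp c n 2 1 * sp c n 2 1) = cup n := by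
  calc (cup n * cup n) ⨾ (w n * sw n n * w n) ⨾ (sp c n 2 1 * sp c n 2 1)
      = (cup n * cup n) ⨾ (w n * sw n n * w n) ⨾ ((sw n n ⨾ sp c n 2 1) * sp c n 2 1) := by
        rw [sw_merge]
    _ = cup n ⨾ (((cup n * w n) ⨾ (w n * sw n n) ⨾ (sw n n * w n)) * w n) ⨾
          (sp c n 2 1 * sp c n 2 1) := by simp
    _ = cup n ⨾ (w n * cup n * w n) ⨾ (sp c n 2 1 * sp c n 2 1) := by
        rw [sw_nat_zero_two' n (dm_cup n) (cd_cup n)]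
    _ = cup n ⨾ (((w n * cup n) ⨾ (sp c n 2 1 * w n)) * w n) ⨾ (w n * sp c n 2 1) := by simp
    _ = cup n ⨾ (sp c n 1 2 * w n) ⨾ (w n * sp c n 2 1) := by
        rw [merge_bend_right]
    _ = cup n ⨾ (w n * (sp c n 1 2 ⨾ sp c n 2 1)) := by
        rw [cup_copy]; simp
    _ = cup n := by rw [copy_merge]; simp

end

/-! ### The Hopf law on single qubits -/

/-- The scalar `√2 ^ n`. -/
def rt (n : ℕ+) : Mor := mk (Diag.bone .green n)

/-- The scalar `1 / √2 ^ n`. -/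
def irt (n : ℕ+) : Mor := mk (Diag.tripleBone .green n)

instance (n : ℕ+) : Scalar (rt n) := ⟨rfl, rfl⟩
instance (n : ℕ+) : Scalar (irt n) := ⟨rfl, rfl⟩

theorem cup_counit (c : Color) (n : ℕ+) : cup n ⨾ (w n * sp c n 1 0) = sp c n 0 1 := by
  rw [← unit_copy c, comp_assoc, copy_counit_right, comp_idl (by simp)]

theorem unit_comp_counit_comm (c c' : Color) (n : ℕ+) :
    sp c n 0 1 ⨾ sp c' n 1 0 = sp c' n 0 1 ⨾ sp c n 1 0 := by
  calc sp c n 0 1 ⨾ sp c' n 1 0 = sp c n 0 1 ⨾ (w n * sp c' n 0 1) ⨾ (sw n n ⨾ cap n) := by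
        rw [sw_cap, comp_assoc, unit_cap]
    _ = sp c n 0 1 ⨾ ((w n * sp c' n 0 1) ⨾ sw n n) ⨾ cap n := by simp only [comp_assoc]
    _ = sp c' n 0 1 ⨾ ((w n * sp c n 0 1) ⨾ cap n) := by
        rw [sw_nat_zero_one n (dm_sp ..) (cd_sp ..)]; simp
    _ = sp c' n 0 1 ⨾ sp c n 1 0 := by rw [unit_cap]

/-- The scalar does not depend on the colours. -/
theorem mk_bone (c : Color) (n : ℕ+) : mk (Diag.bone c n) = rt n := by
  cases c with
  | green => rfl
  | red =>
    exact (mk_comp _ _).trans ((unit_comp_counit_comm .red .green n).trans (mk_comp _ _).symm)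

theorem unit_comp_counit_swap (c : Color) (n : ℕ+) : sp c n 0 1 ⨾ sp c.swap n 1 0 = rt n :=
  (mk_comp _ _).symm.trans (mk_bone c n)

theorem rt_mul_mk_tripleBone_one (c : Color) : rt 1 * mk (Diag.tripleBone c 1) = 1 := by
  rw [← mk_bone c 1, ← mk_tensor]
  exact mk_eq_mk.2 (.bone_inv c)

theorem rt_mul_irt_one : rt 1 * irt 1 = 1 := rt_mul_mk_tripleBone_one .green

theorem irt_mul_rt_one : irt 1 * rt 1 = 1 := by rw [scalar_mul_comm, rt_mul_irt_one]

theorem eq_irt_one_mul {f g : Mor} (h : rt 1 * f = g) : f = irt 1 * g := by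
  rw [← h, ← mul_assoc, irt_mul_rt_one, one_mul]

theorem scalar_comp (s : Mor) [hs : Scalar s] {f : Mor} (hf : dm f = some []) :
    s ⨾ f = s * f := by
  conv_lhs => rw [← mul_one s]
  rw [scalar_mul_comp, one_comp hf]

/-- The copy law. -/
theorem unit_swap_copy (c : Color) :
    sp c.swap 1 0 1 ⨾ sp c 1 1 2 = irt 1 * (sp c.swap 1 0 1 * sp c.swap 1 0 1) := by
  apply eq_irt_one_mul
  have h := mk_eq_mk.2 (Derivable.copy_rule c)
  rw [mk_tensor, mk_bone, mk_comp] at h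
  exact h

theorem unit_swap_merge (c : Color) :
    (w 1 * sp c.swap 1 0 1) ⨾ sp c 1 2 1 = irt 1 * (sp c.swap 1 1 0 ⨾ sp c.swap 1 0 1) := by
  calc (w 1 * sp c.swap 1 0 1) ⨾ sp c 1 2 1
      = (w 1 * (sp c.swap 1 0 1 ⨾ sp c 1 1 2)) ⨾ (cap 1 * w 1) := by
        rw [← copy_bend_left]; simp
    _ = irt 1 * ((w 1 * (sp c.swap 1 0 1 * sp c.swap 1 0 1)) ⨾ (cap 1 * w 1)) := by
        rw [unit_swap_copy, mul_scalar_mul, scalar_mul_comp]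
    _ = irt 1 * (((w 1 * sp c.swap 1 0 1) ⨾ cap 1) ⨾ sp c.swap 1 0 1) := by
        congr 1; simp
    _ = _ := by rw [unit_cap]

/-- A dot of the other colour on one output of the copy disconnects it. -/
theorem copy_counit_swap_right (c : Color) :
    sp c 1 1 2 ⨾ (w 1 * sp c.swap 1 1 0) = irt 1 * (sp c.swap 1 1 0 ⨾ sp c.swap 1 0 1) := by
  calc sp c 1 1 2 ⨾ (w 1 * sp c.swap 1 1 0)
      = (w 1 * (cup 1 ⨾ (w 1 * sp c.swap 1 1 0))) ⨾ sp c 1 2 1 := by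
        rw [← merge_bend_right]; simp
    _ = _ := by rw [cup_counit, unit_swap_merge]

theorem copy_counit_swap_left (c : Color) :
    sp c 1 1 2 ⨾ (sp c.swap 1 1 0 * w 1) = irt 1 * (sp c.swap 1 1 0 ⨾ sp c.swap 1 0 1) := by
  rw [← copy_sw, comp_assoc, sw_nat_one_zero 1 (dm_sp ..) (cd_sp ..), copy_counit_swap_right]

/-- The bialgebra law. -/
theorem merge_swap_copy (c : Color) :
    sp c.swap 1 2 1 ⨾ sp c 1 1 2 =
      rt 1 * ((sp c 1 1 2 * sp c 1 1 2) ⨾ (w 1 * sw 1 1 * w 1) ⨾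
        (sp c.swap 1 2 1 * sp c.swap 1 2 1)) := by
  have h := mk_eq_mk.2 (Derivable.bialgebra c)
  rw [mk_tensor, mk_bone, mk_comp, mk_comp, mk_comp] at h
  rw [mul_assoc (w 1)]
  exact h

/-- The Hopf law: closing one output of the bialgebra law with a dot of the colour of the
merge turns one of its four nodes into a plain wire. -/
theorem hopf_one (c : Color) :
    sp c 1 1 2 ⨾ sp c.swap 1 2 1 = irt 1 * (irt 1 * (sp c 1 1 0 ⨾ sp c.swap 1 0 1)) := by
  have hl : (w 1 * sp c 1 0 1) ⨾ (sp c.swap 1 2 1 ⨾ sp c 1 1 2) ⨾ (sp c.swap 1 1 0 * w 1) =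
      irt 1 * (sp c 1 1 0 ⨾ sp c.swap 1 0 1) := by
    calc (w 1 * sp c 1 0 1) ⨾ (sp c.swap 1 2 1 ⨾ sp c 1 1 2) ⨾ (sp c.swap 1 1 0 * w 1)
        = (w 1 * sp c 1 0 1) ⨾ (sp c.swap 1 2 1 ⨾ (sp c 1 1 2 ⨾ (sp c.swap 1 1 0 * w 1))) := by
          simp only [comp_assoc]
      _ = irt 1 * ((w 1 * sp c 1 0 1) ⨾ (sp c.swap 1 2 1 ⨾ sp c.swap 1 1 0) ⨾
            sp c.swap 1 0 1) := by
          rw [copy_counit_swap_left, comp_scalar_mul, comp_scalar_mul]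
          simp only [comp_assoc]
      _ = _ := by rw [merge_counit, unit_cap]
  have hr : (w 1 * sp c 1 0 1) ⨾ (sp c.swap 1 2 1 ⨾ sp c 1 1 2) ⨾ (sp c.swap 1 1 0 * w 1) =
      rt 1 * (sp c 1 1 2 ⨾ sp c.swap 1 2 1) := by
    rw [merge_swap_copy, comp_scalar_mul (rt 1), scalar_mul_comp (rt 1)]
    congr 1
    calc (w 1 * sp c 1 0 1) ⨾ ((sp c 1 1 2 * sp c 1 1 2) ⨾ (w 1 * sw 1 1 * w 1) ⨾
          (sp c.swap 1 2 1 * sp c.swap 1 2 1)) ⨾ (sp c.swap 1 1 0 * w 1)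
        = (sp c 1 1 2 * (sp c 1 0 1 ⨾ sp c 1 1 2)) ⨾ (w 1 * sw 1 1 * w 1) ⨾
            ((sp c.swap 1 2 1 ⨾ sp c.swap 1 1 0) * sp c.swap 1 2 1) := by simp
      _ = sp c 1 1 2 ⨾ (w 1 * (((w 1 * cup 1) ⨾ (sw 1 1 * w 1)) ⨾ idl [1, 1, 1])) ⨾
            (cap 1 * sp c.swap 1 2 1) := by rw [unit_copy, merge_counit]; simp
      _ = sp c 1 1 2 ⨾ (w 1 * (((w 1 * cup 1) ⨾ (sw 1 1 * w 1) ⨾ (w 1 * sw 1 1)) ⨾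
            (w 1 * sw 1 1))) ⨾ (cap 1 * sp c.swap 1 2 1) := by
          have e : idl [1, 1, 1] = (w 1 * sw 1 1) ⨾ (w 1 * sw 1 1) := by
            rw [mul_comp_mul (by simp) (by simp), sw_sw, comp_idl (by simp), idl_mul_idl]; rfl
          rw [e]
          simp only [comp_assoc]
      _ = sp c 1 1 2 ⨾ (((w 1 * cup 1) ⨾ (cap 1 * w 1)) * w 1) ⨾
            (sw 1 1 ⨾ sp c.swap 1 2 1) := by
          rw [sw_nat_zero_two 1 (dm_cup 1) (cd_cup 1)]; simp
      _ = sp c 1 1 2 ⨾ sp c.swap 1 2 1 := by rw [snake', sw_merge]; simp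
  exact eq_irt_one_mul (hr.symm.trans hl)

theorem Color.swap_swap (c : Color) : c.swap.swap = c := by cases c <;> rfl

/-- The value of a single-qubit circle is `2`. -/
theorem unit_comp_counit_one (c : Color) : sp c 1 0 1 ⨾ sp c 1 1 0 = rt 1 * rt 1 := by
  have h : sp c.swap 1 1 0 = irt 1 * (irt 1 * (sp c.swap 1 1 0 ⨾ (sp c 1 0 1 ⨾ sp c 1 1 0))) := by
    have h := congrArg (· ⨾ sp c 1 1 0) (hopf_one c.swap)
    simp only [Color.swap_swap, comp_assoc, merge_counit, copy_cap, scalar_mul_comp] at h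
    exact h
  have h' := congrArg (sp c 1 0 1 ⨾ ·) h
  simp only [comp_scalar_mul (irt 1)] at h'
  rw [← comp_assoc, unit_comp_counit_swap, scalar_comp (rt 1) (by simp), ← mul_assoc (irt 1) (rt 1),
    irt_mul_rt_one, one_mul] at h'
  nth_rw 2 [h']
  rw [← mul_assoc, rt_mul_irt_one, one_mul]

/-! ### Powers of `√2` -/

/-- The scalar `√2` on a single qubit, as a unit of the monoid of morphisms. -/
def sqrtTwo : Morˣ := ⟨rt 1, irt 1, rt_mul_irt_one, irt_mul_rt_one⟩

/-- The scalar `√2 ^ k`. -/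
def scal (k : ℤ) : Mor := ((sqrtTwo ^ k : Morˣ) : Mor)

instance (k : ℤ) : Scalar (scal k) := by
  have h : ∀ (s : Mor) [Scalar s] (n : ℕ), Scalar (s ^ n) := fun s _ n => by
    induction n with
    | zero => rw [pow_zero]; infer_instance
    | succ n ih => rw [pow_succ]; infer_instance
  obtain ⟨n, rfl | rfl⟩ := k.eq_nat_or_neg
  · rw [scal, zpow_natCast, Units.val_pow_eq_pow_val]
    exact h (rt 1) n
  · rw [scal, zpow_neg, zpow_natCast, ← inv_pow, Units.val_pow_eq_pow_val]
    exact h (irt 1) n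

theorem scal_mul_scal (j k : ℤ) : scal j * scal k = scal (j + k) := by
  rw [scal, scal, scal, zpow_add, Units.val_mul]

theorem scal_mul_scal_mul (j k : ℤ) (f : Mor) : scal j * (scal k * f) = scal (j + k) * f := by
  rw [← mul_assoc, scal_mul_scal]

theorem scal_zero : scal 0 = 1 := rfl
theorem rt_one : rt 1 = scal 1 := by rw [scal, zpow_one]; rfl
theorem irt_one : irt 1 = scal (-1) := by rw [scal, zpow_neg, zpow_one]; rfl

/-! ### Dividers and gatherers -/

theorem pnat_one_add_induction {p : ℕ+ → Prop} (one : p 1) (one_add : ∀ n, p n → p (1 + n))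
    (n : ℕ+) : p n :=
  PNat.recOn n one fun n h => add_comm 1 n ▸ one_add n h

section

variable (c : Color) (n : ℕ+)

theorem dv_ga : dv n ⨾ ga n = w (1 + n) := by
  rw [add_comm]
  exact (mk_comp _ _).symm.trans (mk_eq_mk.2 (.expansion n))

theorem ga_dv : ga n ⨾ dv n = idl [1, n] :=
  (mk_comp _ _).symm.trans (mk_eq_mk.2 (.elimination n))

theorem cup_dv : cup (1 + n) ⨾ (dv n * dv n) = (cup 1 * cup n) ⨾ (w 1 * sw 1 n * w n) := by
  rw [add_comm, mul_assoc (w 1)]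
  exact (mk_comp _ _).symm.trans ((mk_eq_mk.2 (.cup_divide n)).trans (mk_comp _ _))

theorem ga_cap : (ga n * ga n) ⨾ cap (1 + n) = (w 1 * sw n 1 * w n) ⨾ (cap 1 * cap n) := by
  rw [add_comm, mul_assoc (w 1)]
  exact (mk_comp _ _).symm.trans ((mk_eq_mk.2 (.gather_cap n)).trans (mk_comp _ _))

theorem copy_dv : sp c (1 + n) 1 2 ⨾ (dv n * dv n) =
    dv n ⨾ (sp c 1 1 2 * sp c n 1 2) ⨾ (w 1 * sw 1 n * w n) := by
  have h := mk_eq_mk.2 (Derivable.copy_divide c n)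
  rw [mk_comp, mk_comp, mk_comp] at h
  rw [add_comm, mul_assoc (w 1)]
  exact h

theorem unit_dv : sp c (1 + n) 0 1 ⨾ dv n = sp c 1 0 1 * sp c n 0 1 := by
  have h := mk_eq_mk.2 (Derivable.unit_divide c n 0 0)
  have e : (Fin.cons 0 0 : Fin ((n : ℕ) + 1) → ℝ) = 0 := by
    funext i
    exact Fin.cases rfl (fun _ => rfl) i
  rw [mk_comp, e] at h
  rw [add_comm]
  exact h

theorem dv_mul_dv_comp_ga_mul_ga : (dv n * dv n) ⨾ (ga n * ga n) = idl [1 + n, 1 + n] := by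
  rw [mul_comp_mul (by simp) (by simp), dv_ga, idl_mul_idl]; rfl

theorem cup_one_add :
    cup (1 + n) = (cup 1 * cup n) ⨾ (w 1 * sw 1 n * w n) ⨾ (ga n * ga n) := by
  rw [← cup_dv, comp_assoc, dv_mul_dv_comp_ga_mul_ga, comp_idl (by simp)]

theorem unit_one_add : sp c (1 + n) 0 1 = (sp c 1 0 1 * sp c n 0 1) ⨾ ga n := by
  rw [← unit_dv, comp_assoc, dv_ga, comp_idl (by simp)]

theorem ga_copy : ga n ⨾ sp c (1 + n) 1 2 =
    (sp c 1 1 2 * sp c n 1 2) ⨾ (w 1 * sw 1 n * w n) ⨾ (ga n * ga n) := by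
  calc ga n ⨾ sp c (1 + n) 1 2
      = ga n ⨾ (sp c (1 + n) 1 2 ⨾ (dv n * dv n)) ⨾ (ga n * ga n) := by
        rw [comp_assoc, comp_assoc, dv_mul_dv_comp_ga_mul_ga, comp_idl (by simp)]
    _ = (ga n ⨾ dv n) ⨾ ((sp c 1 1 2 * sp c n 1 2) ⨾ (w 1 * sw 1 n * w n) ⨾
          (ga n * ga n)) := by
        rw [copy_dv]; simp only [comp_assoc]
    _ = _ := by rw [ga_dv, idl_comp (by simp)]

theorem ga_counit : ga n ⨾ sp c (1 + n) 1 0 = sp c 1 1 0 * sp c n 1 0 := by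
  calc ga n ⨾ sp c (1 + n) 1 0
      = ga n ⨾ ((w (1 + n) * ((sp c 1 0 1 * sp c n 0 1) ⨾ ga n)) ⨾ cap (1 + n)) := by
        rw [← unit_one_add, unit_cap]
    _ = (w 1 * w n * sp c 1 0 1 * sp c n 0 1) ⨾ ((ga n * ga n) ⨾ cap (1 + n)) := by simp
    _ = (w 1 * ((w n * sp c 1 0 1) ⨾ sw n 1) * sp c n 0 1) ⨾ (cap 1 * cap n) := by
        rw [ga_cap]; simp
    _ = ((w 1 * sp c 1 0 1) ⨾ cap 1) * ((w n * sp c n 0 1) ⨾ cap n) := by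
        rw [sw_nat_zero_one n (dm_sp ..) (cd_sp ..)]; simp
    _ = _ := by rw [unit_cap, unit_cap]

/-- Gatherers pass through a merge. It is the law for the copy with one leg bent, which makes two
additional pairs of crossings cancel. -/
theorem ga_merge : (ga n * ga n) ⨾ sp c (1 + n) 2 1 =
    (w 1 * sw n 1 * w n) ⨾ (sp c 1 2 1 * sp c n 2 1) ⨾ ga n := by
  symm
  calc (w 1 * sw n 1 * w n) ⨾ (sp c 1 2 1 * sp c n 2 1) ⨾ ga n
      = (w 1 * (sw n 1 ⨾ (sp c 1 1 2 * w n)) * w n) ⨾ (w 1 * w 1 * w 1 * w n * sp c n 1 2) ⨾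
          (cap 1 * (w 1 * cap n) * w n) ⨾ ga n := by
        rw [← copy_bend_left, ← copy_bend_left]; simp
    _ = (w 1 * w n * sp c 1 1 2 * sp c n 1 2) ⨾ (w 1 * sw n 1 * w 1 * w n * w n) ⨾
          (w 1 * w 1 * (sw n 1 ⨾ sw 1 n) * w n * w n) ⨾
          (w 1 * w 1 * w n * sw 1 n * w n) ⨾ (cap 1 * cap n * w 1 * w n) ⨾ ga n := by
        rw [← sw_nat_one_two n (dm_sp ..) (cd_sp ..), ← sw_nat_two_zero 1 (dm_cap n) (cd_cap n)]
        simp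
    _ = (w 1 * w n * ((sp c 1 1 2 * sp c n 1 2) ⨾ (w 1 * sw 1 n * w n))) ⨾
          (((w 1 * sw n 1 * w n) ⨾ (cap 1 * cap n)) * (w 1 * w n)) ⨾ ga n := by
        rw [sw_sw]; simp
    _ = (ga n * ((sp c 1 1 2 * sp c n 1 2) ⨾ (w 1 * sw 1 n * w n) ⨾ (ga n * ga n))) ⨾
          (cap (1 + n) * w (1 + n)) := by
        rw [← ga_cap]; simp
    _ = (ga n * ga n) ⨾ ((w (1 + n) * sp c (1 + n) 1 2) ⨾ (cap (1 + n) * w (1 + n))) := by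
        rw [← ga_copy]; simp
    _ = _ := by rw [copy_bend_left]

theorem counit_one_add : sp c (1 + n) 1 0 = dv n ⨾ (sp c 1 1 0 * sp c n 1 0) := by
  rw [← ga_counit, ← comp_assoc, dv_ga, idl_comp (by simp)]

theorem rt_one_add : rt (1 + n) = rt 1 * rt n := by
  rw [← unit_comp_counit_swap .green, unit_one_add, counit_one_add, comp_assoc,
    ← comp_assoc (ga n), ga_dv, idl_comp (by simp), mul_comp_mul (by simp) (by simp),
    unit_comp_counit_swap, unit_comp_counit_swap]

theorem rt_eq_scal : rt n = scal n := by
  induction n using pnat_one_add_induction with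
  | one => exact rt_one
  | one_add n ih => rw [rt_one_add, ih, rt_one, scal_mul_scal, PNat.add_coe]; simp

/-- The Hopf law on registers. -/
theorem hopf : sp c n 1 2 ⨾ sp c.swap n 2 1 =
    scal (-2 * n) * (sp c n 1 0 ⨾ sp c.swap n 0 1) := by
  induction n using pnat_one_add_induction with
  | one => rw [hopf_one, irt_one, scal_mul_scal_mul]; rfl
  | one_add n ih =>
    calc sp c (1 + n) 1 2 ⨾ sp c.swap (1 + n) 2 1
        = dv n ⨾ (ga n ⨾ sp c (1 + n) 1 2) ⨾ sp c.swap (1 + n) 2 1 := by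
          rw [← comp_assoc (dv n), dv_ga, idl_comp (by simp)]
      _ = dv n ⨾ (sp c 1 1 2 * sp c n 1 2) ⨾ (w 1 * sw 1 n * w n) ⨾
            ((ga n * ga n) ⨾ sp c.swap (1 + n) 2 1) := by
          rw [ga_copy]; simp only [comp_assoc]
      _ = dv n ⨾ (sp c 1 1 2 * sp c n 1 2) ⨾ (w 1 * (sw 1 n ⨾ sw n 1) * w n) ⨾
            (sp c.swap 1 2 1 * sp c.swap n 2 1) ⨾ ga n := by
          rw [ga_merge]; simp
      _ = dv n ⨾ ((sp c 1 1 2 ⨾ sp c.swap 1 2 1) * (sp c n 1 2 ⨾ sp c.swap n 2 1)) ⨾ ga n := by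
          rw [sw_sw]; simp
      _ = scal (-2 * ((1 + n : ℕ+) : ℕ)) * (dv n ⨾ ((sp c 1 1 0 ⨾ sp c.swap 1 0 1) *
            (sp c n 1 0 ⨾ sp c.swap n 0 1)) ⨾ ga n) := by
          rw [hopf_one, ih, irt_one, scal_mul_scal_mul, mul_scalar_mul, mul_assoc,
            scal_mul_scal_mul, comp_scalar_mul, scalar_mul_comp, PNat.add_coe]
          congr 2
          push_cast
          ring
      _ = _ := by
          congr 1
          rw [counit_one_add, unit_one_add, ← mul_comp_mul (by simp) (by simp)]
          simp only [comp_assoc]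

theorem cup_copy_right : cup n ⨾ (w n * sp c n 1 2) = sp c n 0 3 := by
  have h := fusion c n 0 0 1 2 0
  simp only [List.replicate_zero, idl_nil, mul_one] at h
  rw [← sp_cup c n]
  exact h

theorem merge_cap_left : (sp c n 2 1 * w n) ⨾ cap n = sp c n 3 0 := by
  have h := fusion c n 2 1 0 0 0
  simp only [List.replicate_zero, idl_nil, one_mul] at h
  rw [← sp_cap c n]
  exact h

/-- Two of the three wires disconnect by the Hopf law. -/
theorem mk_tripleBone : mk (Diag.tripleBone c n) = scal (-n) := by
  calc mk (Diag.tripleBone c n) = sp c n 0 3 ⨾ sp c.swap n 3 0 := mk_comp _ _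
    _ = cup n ⨾ (w n * (sp c n 1 2 ⨾ sp c.swap n 2 1)) ⨾ cap n := by
        rw [← cup_copy_right, ← merge_cap_left, merge_cap]; simp
    _ = scal (-2 * n) * ((cup n ⨾ (w n * sp c n 1 0)) ⨾
          ((w n * sp c.swap n 0 1) ⨾ cap n)) := by
        rw [hopf, mul_scalar_mul, comp_scalar_mul, scalar_mul_comp]
        congr 1
        simp
    _ = scal (-n) := by
        rw [cup_counit, unit_cap, unit_comp_counit_swap, rt_eq_scal, scal_mul_scal]
        congr 1
        ring

end

theorem mul_scal_mul (f : Mor) (k : ℤ) (g : Mor) : f * (scal k * g) = scal k * (f * g) :=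
  mul_scalar_mul ..

theorem scal_mul_comp (k : ℤ) (f g : Mor) : (scal k * f) ⨾ g = scal k * (f ⨾ g) :=
  scalar_mul_comp ..

theorem comp_scal_mul (k : ℤ) (f g : Mor) : f ⨾ (scal k * g) = scal k * (f ⨾ g) :=
  comp_scalar_mul ..

/-- Naturality of the swap in both wires. -/
theorem mul_comp_sw {a b c d : ℕ+} {f g : Mor} (hf : dm f = some [a]) (hf' : cd f = some [b])
    (hg : dm g = some [c]) (hg' : cd g = some [d]) :
    (f * g) ⨾ sw b d = sw a c ⨾ (g * f) := by
  calc (f * g) ⨾ sw b d = (f * w c) ⨾ ((w b * g) ⨾ sw b d) := by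
        rw [← comp_assoc, mul_comp_mul (by rw [hf']; rfl) (by rw [hg]; rfl), comp_idl hf',
          idl_comp hg]
    _ = (f * w c) ⨾ sw b c ⨾ (g * w b) := by rw [sw_nat b hg hg', comp_assoc]
    _ = sw a c ⨾ (g * f) := by
        rw [sw_nat' c hf hf', comp_assoc, mul_comp_mul (by rw [hg]; rfl) (by rw [hf']; rfl),
          idl_comp hg, comp_idl hf']

theorem units_merge (c : Color) (n : ℕ+) :
    (sp c n 0 1 * sp c n 0 1) ⨾ sp c n 2 1 = sp c n 0 1 := by
  calc (sp c n 0 1 * sp c n 0 1) ⨾ sp c n 2 1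
      = ((sp c n 0 1 ⨾ w n) * (1 ⨾ sp c n 0 1)) ⨾ sp c n 2 1 := by
        rw [comp_idl (by simp), one_comp (by simp)]
    _ = sp c n 0 1 ⨾ ((w n * sp c n 0 1) ⨾ sp c n 2 1) := by
        rw [← mul_comp_mul (by simp) (by simp), mul_one, comp_assoc]
    _ = sp c n 0 1 := by rw [unit_merge_right, comp_idl (by simp)]

theorem copy_counits (c : Color) (n : ℕ+) :
    sp c n 1 2 ⨾ (sp c n 1 0 * sp c n 1 0) = sp c n 1 0 := by
  calc sp c n 1 2 ⨾ (sp c n 1 0 * sp c n 1 0)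
      = sp c n 1 2 ⨾ ((w n ⨾ sp c n 1 0) * (sp c n 1 0 ⨾ 1)) := by
        rw [idl_comp (by simp), comp_one (by simp)]
    _ = (sp c n 1 2 ⨾ (w n * sp c n 1 0)) ⨾ sp c n 1 0 := by
        rw [← mul_comp_mul (by simp) (by simp), mul_one, comp_assoc]
    _ = sp c n 1 0 := by rw [copy_counit_right, idl_comp (by simp)]

/-! ### Matrices -/

section

variable {m n : ℕ+}

/-- A matrix with a first row `A`, followed by the rows `B`. -/
theorem mt_rows (A : Matrix (Fin ((1 : ℕ+) : ℕ)) (Fin (n : ℕ)) (ZMod 2))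
    (B : Matrix (Fin (m : ℕ)) (Fin (n : ℕ)) (ZMod 2)) :
    mt (m := 1 + m) (n := n)
        (Matrix.of (Fin.append A B : Fin (((1 : ℕ+) : ℕ) + (m : ℕ)) → Fin (n : ℕ) → ZMod 2)) =
      sp .green n 1 2 ⨾ (mt A * mt B) ⨾ ga m := by
  have h := mk_eq_mk.2 (Derivable.mat_rows A B)
  have e : mk (Diag.gdivide 1 m) = dv m := by
    rw [Diag.gdivide, PNat.recOn_one, mk_cast]; rfl
  rw [mk_comp, mk_comp, mk_tensor, e] at h
  have h' := congrArg (· ⨾ ga m) h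
  simp only [comp_assoc] at h'
  rw [dv_ga, comp_idl (cd_mk _)] at h'
  rw [comp_assoc]
  exact h'

/-- A matrix with a first column `C`, followed by the columns `D`. -/
theorem ga_mt_cols (C : Matrix (Fin (m : ℕ)) (Fin ((1 : ℕ+) : ℕ)) (ZMod 2))
    (D : Matrix (Fin (m : ℕ)) (Fin (n : ℕ)) (ZMod 2)) :
    ga n ⨾ mt (m := m) (n := 1 + n)
        (Matrix.of fun i => (Fin.append (C i) (D i) : Fin (((1 : ℕ+) : ℕ) + (n : ℕ)) → ZMod 2)) =
      scal m * ((mt C * mt D) ⨾ sp .red m 2 1) := by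
  have h := mk_eq_mk.2 (Derivable.mat_cols C D)
  have e : mk (Diag.ggather 1 n) = ga n := by
    rw [Diag.ggather, PNat.recOn_one, mk_cast]; rfl
  rw [mk_comp, mk_tensor, mk_comp, mk_bone, mk_tensor, e, rt_eq_scal] at h
  exact h

theorem exists_mt_rows (M : Matrix (Fin ((1 + m : ℕ+) : ℕ)) (Fin (n : ℕ)) (ZMod 2)) :
    ∃ (A : Matrix (Fin ((1 : ℕ+) : ℕ)) (Fin (n : ℕ)) (ZMod 2))
      (B : Matrix (Fin (m : ℕ)) (Fin (n : ℕ)) (ZMod 2)),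
      mt M = sp .green n 1 2 ⨾ (mt A * mt B) ⨾ ga m := by
  let M' : Fin (((1 : ℕ+) : ℕ) + (m : ℕ)) → Fin (n : ℕ) → ZMod 2 := M
  refine ⟨Matrix.of fun i => M' (Fin.castAdd _ i), Matrix.of fun i => M' (Fin.natAdd _ i), ?_⟩
  rw [← mt_rows]
  exact congrArg (fun N => mt (m := 1 + m) (n := n) (Matrix.of N))
    (Fin.append_castAdd_natAdd (f := M')).symm

theorem exists_mt_cols (M : Matrix (Fin (m : ℕ)) (Fin ((1 + n : ℕ+) : ℕ)) (ZMod 2)) :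
    ∃ (C : Matrix (Fin (m : ℕ)) (Fin ((1 : ℕ+) : ℕ)) (ZMod 2))
      (D : Matrix (Fin (m : ℕ)) (Fin (n : ℕ)) (ZMod 2)),
      ga n ⨾ mt M = scal m * ((mt C * mt D) ⨾ sp .red m 2 1) := by
  let M' : Fin (m : ℕ) → Fin (((1 : ℕ+) : ℕ) + (n : ℕ)) → ZMod 2 := M
  refine ⟨Matrix.of fun i j => M' i (Fin.castAdd _ j), Matrix.of fun i j => M' i (Fin.natAdd _ j),
    ?_⟩
  rw [← ga_mt_cols]
  exact congrArg (fun N => ga n ⨾ mt (m := m) (n := 1 + n) (Matrix.of N))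
    (funext fun i => (Fin.append_castAdd_natAdd (f := M' i)).symm)

theorem mt_one_zero :
    mt (0 : Matrix (Fin ((1 : ℕ+) : ℕ)) (Fin ((1 : ℕ+) : ℕ)) (ZMod 2)) =
      scal (-1) * (sp .green 1 1 0 ⨾ sp .red 1 0 1) := by
  have h := mk_eq_mk.2 Derivable.mat_zero
  rw [mk_tensor, mk_comp, mk_tripleBone] at h
  exact h

theorem mt_one_one :
    mt (1 : Matrix (Fin ((1 : ℕ+) : ℕ)) (Fin ((1 : ℕ+) : ℕ)) (ZMod 2)) = w 1 :=
  mk_eq_mk.2 .mat_one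

/-- The case of a single entry: for the entry `0` both copies are cut, for the entry `1` the claim
is the Hopf law. -/
theorem copy_mt_mt_merge_one_one
    (M : Matrix (Fin ((1 : ℕ+) : ℕ)) (Fin ((1 : ℕ+) : ℕ)) (ZMod 2)) :
    sp .green 1 1 2 ⨾ (mt M * mt M) ⨾ sp .red 1 2 1 =
      scal (-2) * (sp .green 1 1 0 ⨾ sp .red 1 0 1) := by
  have hM : M = 0 ∨ M = 1 := by
    have h : ∀ x : ZMod 2, x = 0 ∨ x = 1 := by decide
    have e : ∀ i j : Fin ((1 : ℕ+) : ℕ), i = j := by decide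
    refine (h (M 0 0)).imp (fun h => ?_) (fun h => ?_)
    · ext i j
      rw [e i 0, e j 0, h]; rfl
    · ext i j
      rw [e i 0, e j 0, h]; rfl
  rcases hM with rfl | rfl
  · rw [mt_one_zero, mul_scalar_mul, mul_assoc, scal_mul_scal_mul, comp_scalar_mul,
      scalar_mul_comp]
    congr 1
    rw [← mul_comp_mul (by simp) (by simp)]
    rw [← comp_assoc, copy_counits, comp_assoc, units_merge]
  · rw [mt_one_one, idl_mul_idl]
    exact (congrArg (· ⨾ _) (comp_idl rfl)).trans (hopf .green 1)

/-- The case of a single row, by induction on the number of columns. -/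
theorem copy_mt_mt_merge_one (M : Matrix (Fin ((1 : ℕ+) : ℕ)) (Fin (n : ℕ)) (ZMod 2)) :
    sp .green n 1 2 ⨾ (mt M * mt M) ⨾ sp .red 1 2 1 =
      scal (-2) * (sp .green n 1 0 ⨾ sp .red 1 0 1) := by
  induction n using pnat_one_add_induction with
  | one => exact copy_mt_mt_merge_one_one M
  | one_add n ih =>
    obtain ⟨C, D, hM⟩ := exists_mt_cols M
    calc sp .green (1 + n) 1 2 ⨾ (mt M * mt M) ⨾ sp .red 1 2 1
        = dv n ⨾ (ga n ⨾ sp .green (1 + n) 1 2) ⨾ (mt M * mt M) ⨾ sp .red 1 2 1 := by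
          rw [← comp_assoc (dv n), dv_ga, idl_comp (by simp)]
      _ = dv n ⨾ (sp .green 1 1 2 * sp .green n 1 2) ⨾ (w 1 * sw 1 n * w n) ⨾
            ((ga n ⨾ mt M) * (ga n ⨾ mt M)) ⨾ sp .red 1 2 1 := by
          rw [ga_copy]; simp
      _ = scal 2 * (dv n ⨾ (sp .green 1 1 2 * sp .green n 1 2) ⨾ (w 1 * sw 1 n * w n) ⨾
            (((mt C * mt D) ⨾ sp .red 1 2 1) * ((mt C * mt D) ⨾ sp .red 1 2 1)) ⨾
              sp .red 1 2 1) := by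
          rw [hM]
          simp only [mul_scal_mul, mul_assoc, scal_mul_comp, comp_scal_mul, scal_mul_scal_mul]
          rfl
      _ = scal 2 * (dv n ⨾ (sp .green 1 1 2 * sp .green n 1 2) ⨾
            (mt C * (sw 1 n ⨾ (mt D * mt C)) * mt D) ⨾ (sp .red 1 2 1 * sp .red 1 2 1) ⨾
              sp .red 1 2 1) := by
          congr 1; simp
      _ = scal 2 * (dv n ⨾ (sp .green 1 1 2 * sp .green n 1 2) ⨾
            (mt C * mt C * mt D * mt D) ⨾ ((w 1 * sw 1 1 * w 1) ⨾
              (sp .red 1 2 1 * sp .red 1 2 1) ⨾ sp .red 1 2 1)) := by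
          rw [← mul_comp_sw (dm_mt C) (cd_mt C) (dm_mt D) (cd_mt D)]
          congr 1; simp
      _ = scal 2 * (dv n ⨾ ((sp .green 1 1 2 ⨾ (mt C * mt C) ⨾ sp .red 1 2 1) *
            (sp .green n 1 2 ⨾ (mt D * mt D) ⨾ sp .red 1 2 1)) ⨾ sp .red 1 2 1) := by
          rw [merge_shuffle]
          congr 1; simp
      _ = scal (-2) * (dv n ⨾ ((sp .green 1 1 0 ⨾ sp .red 1 0 1) *
            (sp .green n 1 0 ⨾ sp .red 1 0 1)) ⨾ sp .red 1 2 1) := by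
          rw [copy_mt_mt_merge_one_one C, ih, mul_scal_mul, mul_assoc (scal (-2)),
            scal_mul_scal_mul, comp_scal_mul, scal_mul_comp, scal_mul_scal_mul]
          rfl
      _ = scal (-2) * (dv n ⨾ (sp .green 1 1 0 * sp .green n 1 0) ⨾
            ((sp .red 1 0 1 * sp .red 1 0 1) ⨾ sp .red 1 2 1)) := by
          rw [← mul_comp_mul (by simp) (by simp)]
          simp only [comp_assoc]
      _ = scal (-2) * (sp .green (1 + n) 1 0 ⨾ sp .red 1 0 1) := by
          rw [units_merge, counit_one_add]

/-- The Hopf law along a matrix: two copies of a wire that go through the same matrix and are then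
added disconnect. -/
theorem copy_mt_mt_merge (M : Matrix (Fin (m : ℕ)) (Fin (n : ℕ)) (ZMod 2)) :
    sp .green n 1 2 ⨾ (mt M * mt M) ⨾ sp .red m 2 1 =
      scal (-2 * m) * (sp .green n 1 0 ⨾ sp .red m 0 1) := by
  induction m using pnat_one_add_induction with
  | one => exact copy_mt_mt_merge_one M
  | one_add m ih =>
    obtain ⟨A, B, hM⟩ := exists_mt_rows M
    calc sp .green n 1 2 ⨾ (mt M * mt M) ⨾ sp .red (1 + m) 2 1
        = sp .green n 1 2 ⨾ (sp .green n 1 2 * sp .green n 1 2) ⨾ (mt A * mt B * mt A * mt B) ⨾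
            ((ga m * ga m) ⨾ sp .red (1 + m) 2 1) := by
          rw [hM]; simp
      _ = sp .green n 1 2 ⨾ (sp .green n 1 2 * sp .green n 1 2) ⨾
            (mt A * ((mt B * mt A) ⨾ sw m 1) * mt B) ⨾
            (sp .red 1 2 1 * sp .red m 2 1) ⨾ ga m := by
          rw [ga_merge]; simp
      _ = (sp .green n 1 2 ⨾ (sp .green n 1 2 * sp .green n 1 2) ⨾ (w n * sw n n * w n)) ⨾
            (mt A * mt A * mt B * mt B) ⨾ (sp .red 1 2 1 * sp .red m 2 1) ⨾ ga m := by
          rw [mul_comp_sw (dm_mt B) (cd_mt B) (dm_mt A) (cd_mt A)]; simp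
      _ = sp .green n 1 2 ⨾ ((sp .green n 1 2 ⨾ (mt A * mt A) ⨾ sp .red 1 2 1) *
            (sp .green n 1 2 ⨾ (mt B * mt B) ⨾ sp .red m 2 1)) ⨾ ga m := by
          rw [copy_shuffle]; simp
      _ = scal (-2 * ((1 + m : ℕ+) : ℕ)) * (sp .green n 1 2 ⨾
            ((sp .green n 1 0 ⨾ sp .red 1 0 1) * (sp .green n 1 0 ⨾ sp .red m 0 1)) ⨾ ga m) := by
          rw [copy_mt_mt_merge_one A, ih, mul_scal_mul, mul_assoc (scal (-2)),
            scal_mul_scal_mul, comp_scal_mul, scal_mul_comp]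
          congr 2
          rw [PNat.add_coe]
          push_cast
          ring
      _ = scal (-2 * ((1 + m : ℕ+) : ℕ)) * (sp .green n 1 2 ⨾
            (sp .green n 1 0 * sp .green n 1 0) ⨾ ((sp .red 1 0 1 * sp .red m 0 1) ⨾ ga m)) := by
          rw [← mul_comp_mul (by simp) (by simp)]
          simp only [comp_assoc]
      _ = _ := by rw [copy_counits, unit_one_add]

end

/-! ### Backward matrices -/

/-- The backward matrix of `A`. -/
def mb {m n : ℕ+} (A : Matrix (Fin (m : ℕ)) (Fin (n : ℕ)) (ZMod 2)) : Mor := mk (Diag.matBack A)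

section

variable {m n : ℕ+} (A : Matrix (Fin (m : ℕ)) (Fin (n : ℕ)) (ZMod 2))

@[simp] theorem dm_mb : dm (mb A) = some [m] := (rfl)
@[simp] theorem cd_mb : cd (mb A) = some [n] := (rfl)

theorem mb_eq : mb A = (cup n * w m) ⨾ (w n * mt A * w m) ⨾ (w n * cap m) := by
  rw [mul_assoc (w n)]
  exact (mk_comp _ _).trans (congrArg (· ⨾ (w n * cap m)) (mk_comp _ _))

/-- The legs of a matrix can be bent to either side. -/
theorem mb_eq' : mb A = (w m * cup n) ⨾ (w m * mt A * w n) ⨾ (cap m * w n) := by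
  calc mb A = (cup n * w m) ⨾ (((w n * mt A) ⨾ sw n m) * w m) ⨾ (w m * sw n m) ⨾
          (cap m * w n) := by
        rw [mb_eq, ← sw_nat_two_zero n (dm_cap m) (cd_cap m)]; simp
    _ = ((cup n ⨾ sw n n) * w m) ⨾ (mt A * w n * w m) ⨾ (w m * sw n m) ⨾ (cap m * w n) := by
        rw [sw_nat n (dm_mt A) (cd_mt A)]; simp
    _ = (cup n * w m) ⨾ (w n * sw n m) ⨾ ((mt A ⨾ w m) * w m * w n) ⨾ (cap m * w n) := by
        rw [cup_sw]; simp
    _ = (cup n * w m) ⨾ (w n * sw n m) ⨾ ((sw n m ⨾ sw m n) * w n) ⨾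
          (mt A * w m * w n) ⨾ (cap m * w n) := by
        rw [sw_sw]; simp
    _ = ((cup n * w m) ⨾ (w n * sw n m) ⨾ (sw n m * w n)) ⨾ ((sw m n ⨾ (mt A * w m)) * w n) ⨾
          (cap m * w n) := by simp
    _ = (w m * cup n) ⨾ (w m * mt A * w n) ⨾ ((sw m m ⨾ cap m) * w n) := by
        rw [sw_nat_zero_two' m (dm_cup n) (cd_cup n), ← sw_nat m (dm_mt A) (cd_mt A)]; simp
    _ = _ := by rw [sw_cap]

end

theorem dagger_spider0 (c : Color) (n : ℕ+) (k l : ℕ) :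
    (Diag.spider0 c n k l).dagger = Diag.spider0 c n l k := by
  rw [Diag.spider0, Diag.dagger, neg_zero]; rfl

theorem mk_dagger_matBack {m n : ℕ+} (A : Matrix (Fin (m : ℕ)) (Fin (n : ℕ)) (ZMod 2)) :
    mk (Diag.matBack A).dagger = mt A := by
  calc mk (Diag.matBack A).dagger = (w n * cup m) ⨾ (w n * mb A * w m) ⨾ (cap n * w m) := by
        rw [Diag.matBack]
        simp only [Diag.dagger, mk_tensor, mk_comp, comp_assoc, mul_assoc]
        rfl
    _ = ((w n * cup n) ⨾ (cap n * w n)) ⨾ mt A ⨾ ((w m * cup m) ⨾ (cap m * w m)) := by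
        rw [mb_eq]; simp
    _ = mt A := by rw [snake', snake', idl_comp (by simp), comp_idl (by simp)]

/-! ### All-ones matrices -/

open CPC

theorem mt_ones_one_one : mt (ones 1 1) = w 1 := by
  rw [← mt_one_one]
  congr 1
  decide

theorem mt_ones_one_add (m : ℕ+) :
    mt (ones (1 + m) 1) = sp .green 1 1 2 ⨾ (w 1 * mt (ones m 1)) ⨾ ga m := by
  rw [← mt_ones_one_one, ← mt_rows]
  refine congrArg (fun N => mt (m := 1 + m) (n := 1) (Matrix.of N)) ?_
  funext i j
  refine Fin.addCases (m := ((1 : ℕ+) : ℕ)) (n := (m : ℕ)) (fun i => ?_) (fun i => ?_) i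
  · exact congrFun (Fin.append_left (ones 1 1) (ones m 1) i).symm j
  · exact congrFun (Fin.append_right (ones 1 1) (ones m 1) i).symm j

theorem ga_mt_ones (n : ℕ+) :
    ga n ⨾ mt (ones 1 (1 + n)) = scal 1 * ((w 1 * mt (ones 1 n)) ⨾ sp .red 1 2 1) := by
  have h := ga_mt_cols (ones 1 1) (ones 1 n)
  rw [mt_ones_one_one] at h
  refine Eq.trans (congrArg (fun N => ga n ⨾ mt (m := 1) (n := 1 + n) (Matrix.of N)) ?_) h
  funext i j
  refine Fin.addCases (m := ((1 : ℕ+) : ℕ)) (n := (n : ℕ)) (fun j => ?_) (fun j => ?_) j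
  · rw [Fin.append_left]; rfl
  · rw [Fin.append_right]; rfl

/-- The copying map `|x⟩ ↦ |x, …, x⟩` preserves the inner product. -/
theorem mt_ones_cap (m : ℕ+) : (mt (ones m 1) * mt (ones m 1)) ⨾ cap m = cap 1 := by
  induction m using pnat_one_add_induction with
  | one => rw [mt_ones_one_one, idl_mul_idl, idl_comp (by simp)]
  | one_add m ih =>
    calc (mt (ones (1 + m) 1) * mt (ones (1 + m) 1)) ⨾ cap (1 + m)
        = (sp .green 1 1 2 * sp .green 1 1 2) ⨾ (w 1 * mt (ones m 1) * w 1 * mt (ones m 1)) ⨾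
            ((ga m * ga m) ⨾ cap (1 + m)) := by
          rw [mt_ones_one_add]; simp
      _ = (sp .green 1 1 2 * sp .green 1 1 2) ⨾ (w 1 * ((mt (ones m 1) * w 1) ⨾ sw m 1) * w 1) ⨾
            (cap 1 * ((w m * mt (ones m 1)) ⨾ cap m)) := by
          rw [ga_cap]; simp
      _ = (sp .green 1 1 2 * sp .green 1 1 2) ⨾ (w 1 * sw 1 1 * w 1) ⨾
            (cap 1 * ((mt (ones m 1) * mt (ones m 1)) ⨾ cap m)) := by
          rw [sw_nat' 1 (dm_mt _) (cd_mt _)]; simp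
      _ = cap 1 := by rw [ih, copy_copy_caps]

/-- The parity map `1_n → 1_1` sends `2 ^ (n - 1)` basis states to each value. -/
theorem cup_mt_ones (n : ℕ+) :
    cup n ⨾ (mt (ones 1 n) * mt (ones 1 n)) = scal (2 * (n - 1)) * cup 1 := by
  induction n using pnat_one_add_induction with
  | one => 
    rw [mt_ones_one_one, idl_mul_idl]
    exact (comp_idl (by simp)).trans (by simp [scal_zero, -mul_eq_lay_comp_lay])
  | one_add n ih =>
    calc cup (1 + n) ⨾ (mt (ones 1 (1 + n)) * mt (ones 1 (1 + n)))
        = (cup 1 * cup n) ⨾ (w 1 * sw 1 n * w n) ⨾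
            ((ga n ⨾ mt (ones 1 (1 + n))) * (ga n ⨾ mt (ones 1 (1 + n)))) := by
          rw [cup_one_add]; simp
      _ = scal 2 * ((cup 1 * cup n) ⨾ (w 1 * sw 1 n * w n) ⨾
            (((w 1 * mt (ones 1 n)) ⨾ sp .red 1 2 1) *
              ((w 1 * mt (ones 1 n)) ⨾ sp .red 1 2 1))) := by
          rw [ga_mt_ones, mul_scal_mul, mul_assoc (scal 1), scal_mul_scal_mul, comp_scal_mul]
          rfl
      _ = scal 2 * ((cup 1 * cup n) ⨾ (w 1 * (sw 1 n ⨾ (mt (ones 1 n) * w 1)) * mt (ones 1 n)) ⨾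
            (sp .red 1 2 1 * sp .red 1 2 1)) := by
          congr 1; simp
      _ = scal 2 * ((cup 1 * (cup n ⨾ (mt (ones 1 n) * mt (ones 1 n)))) ⨾
            (w 1 * sw 1 1 * w 1) ⨾ (sp .red 1 2 1 * sp .red 1 2 1)) := by
          rw [← sw_nat 1 (dm_mt _) (cd_mt _)]
          congr 1; simp
      _ = _ := by
          rw [ih, mul_scal_mul, scal_mul_comp, scal_mul_comp, cups_merge_merge, scal_mul_scal_mul,
            PNat.add_coe]
          congr 2
          push_cast
          ring

theorem mt_ones_mb (m : ℕ+) : mt (ones m 1) ⨾ mb (ones m 1) = w 1 := by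
  calc mt (ones m 1) ⨾ mb (ones m 1)
      = (cup 1 * w 1) ⨾ (w 1 * ((mt (ones m 1) * mt (ones m 1)) ⨾ cap m)) := by
        rw [mb_eq]; simp
    _ = w 1 := by rw [mt_ones_cap, snake]

theorem mb_mt_ones (n : ℕ+) : mb (ones 1 n) ⨾ mt (ones 1 n) = scal (2 * (n - 1)) * w 1 := by
  calc mb (ones 1 n) ⨾ mt (ones 1 n)
      = ((cup n ⨾ (mt (ones 1 n) * mt (ones 1 n))) * w 1) ⨾ (w 1 * cap 1) := by
        rw [mb_eq]; simp
    _ = _ := by rw [cup_mt_ones, mul_assoc, scal_mul_comp, snake]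

theorem prepA_testA (g : Color) (a : ℕ+) : mk (prepA g a) ⨾ mk (testA g a) = 1 := by
  have hp : mk (prepA g a) = scal (-1) * (sp g 1 0 1 ⨾ mt (ones a 1)) := by
    rw [prepA, mk_tensor, mk_tripleBone, mk_comp]; rfl
  have ht : mk (testA g a) = scal (-1) * (mb (ones a 1) ⨾ sp g 1 1 0) := by
    rw [testA, mk_tensor, mk_tripleBone, mk_comp]; rfl
  rw [hp, ht, scal_mul_comp, comp_scal_mul, scal_mul_scal_mul, comp_assoc,
    ← comp_assoc (mt _), mt_ones_mb, idl_comp (by simp), unit_comp_counit_one, rt_one,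
    scal_mul_scal, scal_mul_scal]
  exact scal_zero

theorem prepC_testC (h : Color) (c : ℕ+) : mk (prepC h c) ⨾ mk (testC h c) = 1 := by
  have hp : mk (prepC h c) = scal (-c) * (sp h 1 0 1 ⨾ mb (ones 1 c)) := by
    rw [prepC, mk_tensor, mk_tripleBone, mk_comp]; rfl
  have ht : mk (testC h c) = scal (-c) * (mt (ones 1 c) ⨾ sp h 1 1 0) := by
    rw [testC, mk_tensor, mk_tripleBone, mk_comp]; rfl
  rw [hp, ht, scal_mul_comp, comp_scal_mul, scal_mul_scal_mul, comp_assoc,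
    ← comp_assoc (mb _), mb_mt_ones, scal_mul_comp, comp_scal_mul, idl_comp (by simp),
    unit_comp_counit_one, rt_one, scal_mul_scal, scal_mul_scal, scal_mul_scal, ← scal_zero]
  congr 1
  ring

/-! ### Controlled-NOT gates -/

section

variable {a b : ℕ+} (M : Matrix (Fin (a : ℕ)) (Fin (b : ℕ)) (ZMod 2))

/-- The controlled-NOT along `M`. -/
def cn : Mor := mk (cnot M)

@[simp] theorem dm_cn : dm (cn M) = some [a, b] := (rfl)
@[simp] theorem cd_cn : cd (cn M) = some [a, b] := (rfl)

theorem cn_eq : cn M = scal a * ((w a * sp .green b 1 2) ⨾ (w a * mt M * w b) ⨾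
    (sp .red a 2 1 * w b)) := by
  rw [cn, cnot, mk_tensor, mk_bone, rt_eq_scal, mul_assoc (w a)]
  rw [mk_comp, mk_comp]; rfl

/-- Controlled-NOT gates are involutions: the two dots of either colour fuse, and the two parallel
matrices between them disconnect. -/
theorem cn_cn : cn M ⨾ cn M = idl [a, b] := by
  have h : ((w a * sp .green b 1 2) ⨾ (w a * mt M * w b) ⨾ (sp .red a 2 1 * w b)) ⨾
      ((w a * sp .green b 1 2) ⨾ (w a * mt M * w b) ⨾ (sp .red a 2 1 * w b)) =
      scal (-2 * a) * idl [a, b] := by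
    calc ((w a * sp .green b 1 2) ⨾ (w a * mt M * w b) ⨾ (sp .red a 2 1 * w b)) ⨾
          ((w a * sp .green b 1 2) ⨾ (w a * mt M * w b) ⨾ (sp .red a 2 1 * w b))
        = (w a * (sp .green b 1 2 ⨾ (w b * sp .green b 1 2))) ⨾ (w a * mt M * mt M * w b) ⨾
            (((sp .red a 2 1 * w a) ⨾ sp .red a 2 1) * w b) := by simp
      _ = (w a * sp .green b 1 2) ⨾
            (w a * (sp .green b 1 2 ⨾ (mt M * mt M) ⨾ sp .red a 2 1) * w b) ⨾
            (sp .red a 2 1 * w b) := by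
          rw [← copy_assoc, merge_assoc]; simp
      _ = scal (-2 * a) * ((w a * sp .green b 1 2) ⨾
            (w a * (sp .green b 1 0 ⨾ sp .red a 0 1) * w b) ⨾ (sp .red a 2 1 * w b)) := by
          rw [copy_mt_mt_merge, mul_scal_mul, mul_assoc (scal _), comp_scal_mul, scal_mul_comp]
      _ = scal (-2 * a) * (((w a * sp .green b 1 2) ⨾ (w a * sp .green b 1 0 * w b)) ⨾
            ((w a * sp .red a 0 1 * w b) ⨾ (sp .red a 2 1 * w b))) := by
          have e : w a * (sp .green b 1 0 ⨾ sp .red a 0 1) * w b =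
              (w a * sp .green b 1 0 * w b) ⨾ (w a * sp .red a 0 1 * w b) :=
            lay_comp [a] [b] (by simp)
          rw [e]
          simp only [comp_assoc]
      _ = scal (-2 * a) * ((w a * (sp .green b 1 2 ⨾ (sp .green b 1 0 * w b))) ⨾
            (((w a * sp .red a 0 1) ⨾ sp .red a 2 1) * w b)) := by
          congr 2 <;> simp
      _ = _ := by
          rw [copy_counit_left, unit_merge_right, idl_mul_idl]
          exact congrArg (scal (-2 * a) * ·) (idl_comp rfl)
  rw [cn_eq, scal_mul_comp, comp_scal_mul, scal_mul_scal_mul, h, scal_mul_scal_mul]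
  have e : (a : ℤ) + a + -2 * a = 0 := by ring
  rw [e, scal_zero, one_mul]

/-- Controlled-NOT gates are self-adjoint: the wires that join the two dots to the backward matrix
are bent back. -/
theorem mk_dagger_cnot : mk (cnot M).dagger = cn M := by
  have hd : mk (cnot M).dagger = scal a * ((sp .red a 1 2 * w b) ⨾ (w a * mb M * w b) ⨾
      (w a * sp .green b 2 1)) := by
    have hb : mk (Diag.bone .green a).dagger = scal a := by
      rw [← rt_eq_scal, ← mk_bone .red]
      simp only [Diag.bone, Diag.unit, Diag.counit, Diag.dagger, dagger_spider0]
      rfl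
    rw [mul_assoc (w a), ← hb]
    simp only [cnot, Diag.copy, Diag.merge, Diag.wire, Diag.dagger, dagger_spider0, mk_tensor,
      mk_comp, comp_assoc]
    rfl
  rw [hd, cn_eq]
  congr 1
  symm
  calc (w a * sp .green b 1 2) ⨾ (w a * mt M * w b) ⨾ (sp .red a 2 1 * w b)
      = (w a * ((cup b * w b) ⨾ (w b * sp .green b 2 1))) ⨾ (w a * mt M * w b) ⨾
          (((sp .red a 1 2 * w a) ⨾ (w a * cap a)) * w b) := by
        rw [merge_bend_left, copy_bend_right]
    _ = (sp .red a 1 2 * w b) ⨾ (w a * ((w a * cup b) ⨾ (w a * mt M * w b) ⨾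
          (cap a * w b)) * w b) ⨾ (w a * sp .green b 2 1) := by simp
    _ = _ := by rw [← mb_eq']

end

/-! ### The encoder and the decoder -/

section

variable {a b c : ℕ+} (B : Matrix (Fin (a : ℕ)) (Fin (b : ℕ)) (ZMod 2))
  (P : Matrix (Fin (c : ℕ)) (Fin (b : ℕ)) (ZMod 2))
  (C : Matrix (Fin (c : ℕ)) (Fin (a : ℕ)) (ZMod 2))

theorem mk_bitCheck : mk (bitCheck (c := c) B) = cn B * w c := rfl

theorem mk_phaseCheck : mk (phaseCheck (a := a) P) = w a * cn P.transpose := rfl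

theorem mk_crossCheck : mk (crossCheck (b := b) C) =
    (w a * sw b c) ⨾ (cn C.transpose * w b) ⨾ (w a * sw c b) := by
  rw [crossCheck, mk_comp, mk_comp]; rfl

theorem bitCheck_bitCheck :
    mk (bitCheck (c := c) B) ⨾ mk (bitCheck (c := c) B) = idl [a, b, c] := by
  rw [mk_bitCheck, mul_comp_mul (by simp) (by simp), cn_cn, comp_idl (by simp), idl_mul_idl]
  rfl

theorem phaseCheck_phaseCheck :
    mk (phaseCheck (a := a) P) ⨾ mk (phaseCheck (a := a) P) = idl [a, b, c] := by
  rw [mk_phaseCheck, mul_comp_mul (by simp) (by simp), cn_cn, comp_idl (by simp), idl_mul_idl]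
  rfl

theorem crossCheck_crossCheck :
    mk (crossCheck (b := b) C) ⨾ mk (crossCheck (b := b) C) = idl [a, b, c] := by
  rw [mk_crossCheck]
  calc (w a * sw b c) ⨾ (cn C.transpose * w b) ⨾ (w a * sw c b) ⨾
        ((w a * sw b c) ⨾ (cn C.transpose * w b) ⨾ (w a * sw c b))
      = (w a * sw b c) ⨾ (cn C.transpose * w b) ⨾ (w a * (sw c b ⨾ sw b c)) ⨾
          (cn C.transpose * w b) ⨾ (w a * sw c b) := by simp
    _ = (w a * sw b c) ⨾ ((cn C.transpose ⨾ cn C.transpose) * w b) ⨾ (w a * sw c b) := by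
        rw [sw_sw]; simp
    _ = w a * (sw b c ⨾ sw c b) := by rw [cn_cn]; simp
    _ = idl [a, b, c] := by rw [sw_sw, idl_mul_idl]; rfl

theorem mk_dagger_bitCheck : mk (bitCheck (c := c) B).dagger = mk (bitCheck (c := c) B) :=
  congrArg (· * w c) (mk_dagger_cnot B)

theorem mk_dagger_phaseCheck :
    mk (phaseCheck (a := a) P).dagger = mk (phaseCheck (a := a) P) :=
  congrArg (w a * ·) (mk_dagger_cnot P.transpose)

theorem mk_dagger_crossCheck :
    mk (crossCheck (b := b) C).dagger = mk (crossCheck (b := b) C) := by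
  have h := mk_dagger_cnot C.transpose
  rw [mk_crossCheck, crossCheck]
  simp only [Diag.dagger, mk_comp, mk_tensor, h, comp_assoc]
  rfl

end

theorem mk_dagger_tripleBone (c : Color) (n : ℕ+) :
    mk (Diag.tripleBone c n).dagger = scal (-n) := by
  rw [← mk_tripleBone c.swap]
  simp only [Diag.tripleBone, Diag.dagger, dagger_spider0, Color.swap_swap]

theorem mk_dagger_prepA (g : Color) (a : ℕ+) : mk (prepA g a).dagger = mk (testA g a) := by
  simp only [prepA, testA, Diag.dagger, mk_tensor, mk_dagger_tripleBone, mk_tripleBone,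
    Diag.unit, dagger_spider0]
  rfl

theorem mk_dagger_prepC (h : Color) (c : ℕ+) : mk (prepC h c).dagger = mk (testC h c) := by
  simp only [prepC, testC, Diag.dagger, mk_tensor, mk_comp, mk_dagger_tripleBone, mk_tripleBone,
    mk_dagger_matBack, Diag.unit, dagger_spider0]
  rfl

variable {a b c : ℕ+} (B : Matrix (Fin (a : ℕ)) (Fin (b : ℕ)) (ZMod 2))
  (P : Matrix (Fin (c : ℕ)) (Fin (b : ℕ)) (ZMod 2))
  (C : Matrix (Fin (c : ℕ)) (Fin (a : ℕ)) (ZMod 2)) (g h : Color)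

theorem mk_encoder : mk (encoder g h B P C) =
    (mk (prepA g a) * w b * mk (prepC h c)) ⨾ mk (bitCheck (c := c) B) ⨾
      mk (crossCheck (b := b) C) ⨾ mk (phaseCheck (a := a) P) := by
  rw [encoder, mk_comp, mk_comp, mk_comp, mul_assoc]
  rfl

theorem mk_decoder : mk (decoder g h B P C) =
    mk (phaseCheck (a := a) P) ⨾ mk (crossCheck (b := b) C) ⨾ mk (bitCheck (c := c) B) ⨾
      (mk (testA g a) * w b * mk (testC h c)) := by
  rw [decoder, mk_comp, mk_comp, mk_comp, mul_assoc]
  rfl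

/-- The decoder is the adjoint of the encoder. -/
theorem mk_dagger_encoder : mk (encoder g h B P C).dagger = mk (decoder g h B P C) := by
  rw [mk_decoder, encoder]
  simp only [Diag.dagger, mk_comp, mk_tensor, mk_dagger_bitCheck, mk_dagger_crossCheck,
    mk_dagger_phaseCheck, mk_dagger_prepA, mk_dagger_prepC, comp_assoc, mul_assoc]
  rfl

theorem encoder_decoder :
    mk (encoder g h B P C) ⨾ mk (decoder g h B P C) = w b := by
  calc mk (encoder g h B P C) ⨾ mk (decoder g h B P C)
      = (mk (prepA g a) * w b * mk (prepC h c)) ⨾ (mk (bitCheck (c := c) B) ⨾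
          (mk (crossCheck (b := b) C) ⨾ ((mk (phaseCheck (a := a) P) ⨾
            mk (phaseCheck (a := a) P)) ⨾ mk (crossCheck (b := b) C))) ⨾
              mk (bitCheck (c := c) B)) ⨾ (mk (testA g a) * w b * mk (testC h c)) := by
        rw [mk_encoder, mk_decoder]; simp only [comp_assoc]
    _ = (mk (prepA g a) * w b * mk (prepC h c)) ⨾ (mk (testA g a) * w b * mk (testC h c)) := by
        rw [phaseCheck_phaseCheck, idl_comp (dm_mk _), crossCheck_crossCheck,
          comp_idl (cd_mk _), bitCheck_bitCheck, comp_idl (by simp)]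
    _ = (mk (prepA g a) ⨾ mk (testA g a)) * (w b ⨾ w b) *
          (mk (prepC h c) ⨾ mk (testC h c)) := by
        rw [mul_comp_mul (by simp) (by simp), mul_comp_mul (by simp) (by simp)]
    _ = w b := by
        rw [prepA_testA, prepC_testC, idl_comp (by simp), one_mul, mul_one]

end SZX

end

theorem mainTheorem11 {a b c : ℕ+}
    (B : Matrix (Fin (a : ℕ)) (Fin (b : ℕ)) (ZMod 2))
    (P : Matrix (Fin (c : ℕ)) (Fin (b : ℕ)) (ZMod 2))
    (C : Matrix (Fin (c : ℕ)) (Fin (a : ℕ)) (ZMod 2))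
    (g h : SZX.Color) :
    SZX.Derivable
      (SZX.Diag.comp (SZX.CPC.encoder g h B P C) (SZX.CPC.decoder g h B P C))
      (SZX.Diag.id [b]) ∧
    SZX.Derivable
      (SZX.Diag.comp (SZX.CPC.encoder g h B P C) (SZX.CPC.encoder g h B P C).dagger)
      (SZX.Diag.id [b]) := by
  rw [← SZX.mk_eq_mk, ← SZX.mk_eq_mk, SZX.mk_comp, SZX.mk_comp, SZX.mk_dagger_encoder]
  exact ⟨SZX.encoder_decoder B P C g h, SZX.encoder_decoder B P C g h⟩
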